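/- Let $D(T(2,3))$ be the positive-clasped untwisted (Whitehead) double of the right-handed trefoil $T(2,3)$. For a knot $J$ and an odd integer $n\ge 1$ let $K_n(J)$ be the boundary of the following punctured Klein bottle in $S^3$: start from the standard surface bounded by the three-stranded pretzel diagram with columns of $n$, $-n$ and $n-1$ half-twists (positive means right-handed), that is, two disks joined by three twisted bands, and tie the first band into $J$ with framing $0$. Equivalently, regarding the two disks and the middle band (the $n$ half-twists between the other two bands) as one disk, the left band is tied into $J$ and forms with it an annulus of framing $0$, and the right band forms with it an unknotted Möbius band with one left-handed half-twist. Let $J_n$ be the connected sum of $(3n-1)/4$ copies of $D(T(2,3))$ if $n\equiv 3 \pmod 4$; more generally, let $J_n$ be the connected sum of any number $m\ge 0$ of copies of $D(T(2,3))$. Then for every odd $n\ge 1$ the curve $K_n=K_n(J_n)$ is a knot, and its Alexander polynomial, which is defined up to multiplication by units $\pm t^k$ of $\mathbb Z[t,t^{-1}]$, is $$\Delta_{K_n}(t)=\left(\frac{t^n+1}{t+1}\right)^2 .$$ -/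

import Mathlib

namespace KnotDiag

/-! Oriented tangle diagrams in the plane, written as words read from bottom to top.  At each
height the diagram meets the horizontal line in finitely many strands, at positions
`0, 1, 2, …` from left to right. -/

/-- The elementary pieces of a diagram.
* `cross i o`: the strands at positions `i`, `i + 1` cross.  If `o = true`, the strand running from
  bottom left to top right is the over-strand; if `o = false`, the other one is.
* `cup i d`: a local minimum, creating two strands at positions `i`, `i + 1`; the left one is
  oriented upwards if `d = true` and downwards if `d = false`, the right one oppositely.
* `cap i`: a local maximum, joining the strands at positions `i`, `i + 1`. -/
inductive Letter where
  | cross (i : ℕ) (o : Bool)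
  | cup (i : ℕ) (d : Bool)
  | cap (i : ℕ)

/-- A diagram (or its part below some height).  Its arcs are numbered `0, …, arcs - 1`; an arc runs
from undercrossing to undercrossing, except that it is also cut at local maxima.
* `strands`: the arcs met at the top, from left to right, with their orientation
  (`true` for upwards).
* `crossings`: for every crossing `(x, l, r)` the over-arc `x` and the two under-arcs, `l` on
  the left and `r` on the right of the oriented over-arc.
* `joins`: the pairs of arcs that are joined at a local maximum.
* `writhe`: the sum of the signs of the crossings. -/
structure Diagram where
  strands : List (ℕ × Bool)
  arcs : ℕ
  crossings : List (ℕ × ℕ × ℕ)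
  joins : List (ℕ × ℕ)
  writhe : ℤ

/-- The sign of a crossing `cross i o` whose lower left and lower right strands have the
orientations `d` and `e`. -/
def crossingSign (o d e : Bool) : ℤ := if o = (d == e) then 1 else -1

/-- Put one more piece on top of a diagram; `none` if the piece does not fit. -/
def Diagram.step (D : Diagram) : Letter → Option Diagram
  | .cross i true =>
    match D.strands.drop i with
    | (a, d) :: (b, e) :: rest => some
        { strands := D.strands.take i ++ (D.arcs, e) :: (a, d) :: rest
          arcs := D.arcs + 1
          crossings := D.crossings ++ [if d then (a, D.arcs, b) else (a, b, D.arcs)]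
          joins := D.joins
          writhe := D.writhe + crossingSign true d e }
    | _ => none
  | .cross i false =>
    match D.strands.drop i with
    | (a, d) :: (b, e) :: rest => some
        { strands := D.strands.take i ++ (b, e) :: (D.arcs, d) :: rest
          arcs := D.arcs + 1
          crossings := D.crossings ++ [if e then (b, a, D.arcs) else (b, D.arcs, a)]
          joins := D.joins
          writhe := D.writhe + crossingSign false d e }
    | _ => none
  | .cup i d =>
    if i ≤ D.strands.length then some
        { strands := D.strands.take i ++ (D.arcs, d) :: (D.arcs, !d) :: D.strands.drop i
          arcs := D.arcs + 1
          crossings := D.crossings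
          joins := D.joins
          writhe := D.writhe }
    else none
  | .cap i =>
    match D.strands.drop i with
    | (a, d) :: (b, e) :: rest =>
      if d = e then none else some
        { strands := D.strands.take i ++ rest
          arcs := D.arcs
          crossings := D.crossings
          joins := D.joins ++ [(a, b)]
          writhe := D.writhe }
    | _ => none

/-- Put a word on top of a diagram. -/
def Diagram.run (D : Diagram) (w : List Letter) : Option Diagram :=
  w.foldlM Diagram.step D

/-- The empty diagram. -/
def Diagram.empty : Diagram := ⟨[], 0, [], [], 0⟩

/-- A single strand, oriented upwards. -/
def Diagram.strand : Diagram := ⟨[(0, true)], 1, [], [], 0⟩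

/-- Two arcs that follow each other on the same component. -/
def Diagram.Adjacent (D : Diagram) (a b : ℕ) : Prop :=
  (∃ x, (x, a, b) ∈ D.crossings) ∨ (a, b) ∈ D.joins

/-- `D` is a closed diagram with exactly one component. -/
def Diagram.IsKnot (D : Diagram) : Prop :=
  D.strands = [] ∧ 0 < D.arcs ∧
    ∀ a < D.arcs, ∀ b < D.arcs, Relation.EqvGen D.Adjacent a b

/-! ### The Alexander polynomial -/

open LaurentPolynomial in
/-- The row `(1 - t) x + t l - r` of a crossing with over-arc `x`, left under-arc `l` and right
under-arc `r`: the Fox derivatives of the Wirtinger relation, abelianized. -/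
noncomputable def crossingRow {N : ℕ} (c : ℕ × ℕ × ℕ) (j : Fin N) : LaurentPolynomial ℤ :=
  (if j = c.1 then 1 - T 1 else 0) + (if j = c.2.1 then T 1 else 0) - (if j = c.2.2 then 1 else 0)

/-- The row `a - b` of two arcs `a`, `b` joined at a local maximum. -/
noncomputable def joinRow {N : ℕ} (c : ℕ × ℕ) (j : Fin N) : LaurentPolynomial ℤ :=
  (if j = c.1 then 1 else 0) - (if j = c.2 then 1 else 0)

/-- The rows of the Alexander matrix. -/
noncomputable def Diagram.rows (D : Diagram) : List (Fin D.arcs → LaurentPolynomial ℤ) :=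
  D.crossings.map crossingRow ++ D.joins.map joinRow

/-- The Alexander matrix: a row for each relation, a column for each arc. -/
noncomputable def Diagram.alexanderMatrix (D : Diagram) :
    Matrix (Fin D.rows.length) (Fin D.arcs) (LaurentPolynomial ℤ) :=
  Matrix.of fun i j => D.rows.get i j

/-- The first elementary ideal (Alexander ideal): generated by the minors of the Alexander matrix
whose size is the number of arcs minus one. -/
noncomputable def Diagram.alexanderIdeal (D : Diagram) : Ideal (LaurentPolynomial ℤ) :=
  Ideal.span {x | ∃ (f : Fin (D.arcs - 1) → Fin D.rows.length) (g : Fin (D.arcs - 1) → Fin D.arcs),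
    x = (D.alexanderMatrix.submatrix f g).det}

/-- The word `w` is a diagram of a knot, and `p` is an Alexander polynomial of this knot: a greatest
common divisor of the first elementary ideal (so it is determined up to a unit `± t ^ k`). -/
def IsAlexanderPolynomial (w : List Letter) (p : LaurentPolynomial ℤ) : Prop :=
  ∃ D : Diagram, Diagram.empty.run w = some D ∧ D.IsKnot ∧
    (∀ x ∈ D.alexanderIdeal, p ∣ x) ∧
    ∀ q : LaurentPolynomial ℤ, (∀ x ∈ D.alexanderIdeal, q ∣ x) → q ∣ p

/-! ### Long knots, cables and doubles

A long knot is a word that leads from a single strand (at position `0`, oriented upwards) to a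
single strand; closing it up around the right gives the knot.  The connected sum of long knots is
the concatenation of the words. -/

/-- `k` half-twists of the strands at positions `i`, `i + 1`: right-handed for `k > 0`,
left-handed for `k < 0`. -/
def halfTwists (i : ℕ) (k : ℤ) : List Letter :=
  List.replicate k.natAbs (.cross i (decide (0 < k)))

/-- The writhe of a long knot diagram, that is, its blackboard framing. -/
def writhe (w : List Letter) : ℤ :=
  ((Diagram.strand.run w).map Diagram.writhe).getD 0

/-- Each strand is replaced by two parallel copies in the plane.  With `par = true` both are
oriented like the strand.  With `par = false` the copy on the left, seen along the
oriented strand, is oriented like it, and the other one oppositely; so in each pair the left one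
in the plane points upwards, the right one downwards. -/
def doubleLetter (par : Bool) : Letter → List Letter
  | .cross i o => [.cross (2 * i + 1) o, .cross (2 * i) o, .cross (2 * i + 2) o,
      .cross (2 * i + 1) o]
  | .cup i d => if par then [.cup (2 * i) d, .cup (2 * i + 1) d]
      else [.cup (2 * i) true, .cup (2 * i + 1) false]
  | .cap i => [.cap (2 * i + 1), .cap (2 * i)]

/-- The band along a long knot `w` with framing `0`: the two parallel copies of `w`, with full
twists that undo the writhe. -/
def zeroFramedBand (par : Bool) (w : List Letter) : List Letter :=
  w.flatMap (doubleLetter par) ++ halfTwists 0 (-2 * writhe w)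

/-- The right-handed trefoil `T(2,3)`, as a long knot. -/
def trefoil : List Letter := .cup 1 true :: halfTwists 0 3 ++ [.cap 1]

/-- The positive-clasped untwisted double of a long knot: the two oppositely oriented strands of
the band with framing `0` are closed by a clasp with two positive crossings. -/
def whiteheadDouble (w : List Letter) : List Letter :=
  .cup 1 false :: zeroFramedBand false w ++ [.cross 1 false, .cross 1 false, .cap 0]

/-- The connected sum of `m` copies of a long knot. -/
def connectedSum (m : ℕ) (w : List Letter) : List Letter := (List.replicate m w).flatten

/-- The knot `K_n(J)`, as the boundary of a punctured Klein bottle.  The surface is a disk with two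
bands.  The disk is a strip (at positions `2`, `3`) with `n` left-handed half-twists, between the
two bands.  The left band (at positions `0`, `1`) is tied into the long knot `J` with framing
`0`, and its `n` right-handed half-twists compensate those of the strip, so that the annulus that
it forms with the disk has framing `0`.  The right band (at positions `4`, `5`) has `n - 1`
half-twists, so that it forms with the disk a Möbius band with one left-handed half-twist. -/
def K (n : ℕ) (J : List Letter) : List Letter :=
  [.cup 0 true, .cup 1 true, .cup 3 false] ++
  zeroFramedBand true J ++
  halfTwists 0 n ++ halfTwists 2 (-n) ++ halfTwists 4 (n - 1) ++
  [.cap 1, .cap 1, .cap 0]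

end KnotDiag

/-! An abelian group with commuting operators `T` and `L` that satisfy `L ^ 2 = L - T * L` colours
framed tangle diagrams.  The double of a tangle is coloured by such a rack on `V` exactly if the
tangle is coloured by a rack on `V × V`.  For oppositely oriented copies that rack has `T = 1`, and
then the trefoil has only the trivial colourings.  So its Whitehead double has only the trivial
colourings for all of these racks, the same holds for the connected sums `J`, and, after one more
doubling, the zero-framed band along `J` acts on the colours of an Alexander quandle like two
parallel strands.

Hence the colourings of `K n J` by an Alexander quandle are determined by the colours of three local
minima, which are subject to the two relations of the pretzel diagram.  Eliminating all other arcs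
from the Alexander matrix leaves the `2 × 2` determinant of these relations, which generates the
first elementary ideal and is, up to a unit, the square of `1 - t + ⋯ + t ^ (n - 1)`.  For `t = 1`
and colours in `ℤ` the relations force all arcs to have the same colour, so there is only one
component. -/

namespace KnotDiag

section

variable {α β : Type*}

theorem eq_append_of_drop_eq {l r : List α} {i : ℕ} {x y : α}
    (h : l.drop i = x :: y :: r) : ∃ p : List α, p.length = i ∧ l = p ++ x :: y :: r := by
  have hi : i < l.length := by
    by_contra hi
    simp [List.drop_of_length_le (not_lt.1 hi)] at h
  exact ⟨l.take i, by simp [hi.le], by rw [← h, List.take_append_drop]⟩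

theorem exists_cons_cons_eq_and {a b : α} {l : List α} {P : α → α → List α → Prop} :
    (∃ x y r, a :: b :: l = x :: y :: r ∧ P x y r) ↔ P a b l := by
  constructor
  · rintro ⟨_, _, _, ⟨⟩, h⟩
    exact h
  · exact fun h => ⟨a, b, l, rfl, h⟩

theorem exists_of_map_eq_append_cons_cons {f : α → β} {s : List α} {u v : List β}
    {z z' : β} (h : s.map f = u ++ z :: z' :: v) :
    ∃ p x y r, s = p ++ x :: y :: r ∧ p.map f = u ∧ f x = z ∧ f y = z' ∧ r.map f = v := by
  obtain ⟨p, _, rfl, rfl, h₁⟩ := List.map_eq_append_iff.1 h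
  obtain ⟨x, _, rfl, rfl, h₂⟩ := List.map_eq_cons_iff.1 h₁
  obtain ⟨y, r, rfl, rfl, rfl⟩ := List.map_eq_cons_iff.1 h₂
  exact ⟨p, x, y, r, rfl, rfl, rfl, rfl, rfl⟩

end

theorem perm_zpow_apply_eq_add_zsmul {V : Type*} [AddCommGroup V] {e : Equiv.Perm V} {f : V → V}
    (he : ∀ x, e x = x + f x) (hf : ∀ x, f (e x) = f x) (k : ℤ) (x : V) :
    (e ^ k) x = x + k • f x := by
  induction k generalizing x with
  | zero => simp
  | succ k ih =>
    rw [zpow_add_one, Equiv.Perm.mul_apply, ih, hf, he, add_smul, one_smul]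
    abel
  | pred k ih =>
    obtain ⟨x, rfl⟩ := e.surjective x
    rw [zpow_sub_one, Equiv.Perm.mul_apply, Equiv.Perm.inv_def, Equiv.symm_apply_apply, ih, hf, he,
      sub_smul, one_smul]
    abel

section

variable {R : Type*} [CommRing R]

/-- The alternating geometric sum `1 - s + s ^ 2 - ⋯` with `k` terms. -/
def altGeomSum (s : R) (k : ℕ) : R := ∑ i ∈ Finset.range k, (-s) ^ i

theorem altGeomSum_succ (s : R) (k : ℕ) : altGeomSum s (k + 1) = 1 - s * altGeomSum s k := by
  rw [altGeomSum, geom_sum_succ, altGeomSum]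
  ring

theorem one_add_mul_altGeomSum (s : R) (k : ℕ) : (1 + s) * altGeomSum s k = 1 - (-s) ^ k := by
  rw [altGeomSum, ← mul_neg_geom_sum, sub_neg_eq_add]

theorem pow_mul_altGeomSum_inv (t : Rˣ) (k : ℕ) :
    (t : R) ^ (2 * k) * altGeomSum ((t⁻¹ : Rˣ) : R) (2 * k + 1) =
      altGeomSum (t : R) (2 * k + 1) := by
  rw [altGeomSum, altGeomSum, Finset.mul_sum, ← Finset.sum_range_reflect]
  refine Finset.sum_congr rfl fun i hi => ?_
  have hi' : i + (2 * k + 1 - 1 - i) = 2 * k := by grind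
  rw [← (even_two_mul k).neg_pow, ← hi', pow_add, mul_assoc, hi', Nat.add_sub_cancel, ← mul_pow]
  simp

end

/-! ### Minors and the elimination of unknowns -/

section Minors

universe u v

variable {R : Type u} [CommRing R] {m m' ι ι' : Type*} [Fintype ι] [DecidableEq ι] [Fintype ι']
  [DecidableEq ι'] {n σ τ : Type v}

/-- The ideal that is generated by the minors of the matrix `A` whose rows and columns are indexed
by `ι`. -/
def minorIdeal (ι : Type*) [Fintype ι] [DecidableEq ι] (A : Matrix m n R) : Ideal R :=
  Ideal.span {x | ∃ (f : ι → m) (g : ι → n), x = (A.submatrix f g).det}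

theorem minorIdeal_submatrix_equiv {n' : Type*} (A : Matrix m n R) (eι : ι ≃ ι') (e : n' ≃ n) :
    minorIdeal ι (A.submatrix id e) = minorIdeal ι' A := by
  refine congrArg Ideal.span (Set.ext fun x => ⟨?_, ?_⟩)
  · rintro ⟨f, g, rfl⟩
    exact ⟨f ∘ eι.symm, e ∘ g ∘ eι.symm, (Matrix.det_submatrix_equiv_self eι.symm _).symm⟩
  · rintro ⟨f, g, rfl⟩
    refine ⟨f ∘ eι, e.symm ∘ g ∘ eι, ?_⟩
    rw [← Matrix.det_submatrix_equiv_self eι]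
    congr 1
    ext i j
    simp

theorem minorIdeal_mul_eq_span_det (Z : Matrix ι ι R) (B : Matrix ι n R) (g : ι → n)
    (hg : IsUnit (B.submatrix id g).det) : minorIdeal ι (Z * B) = Ideal.span {Z.det} := by
  refine le_antisymm (Ideal.span_le.2 ?_) ((Ideal.span_singleton_le_iff_mem _).2 ?_)
  · rintro _ ⟨f, g, rfl⟩
    have h : (Z * B).submatrix f g = (1 : Matrix ι ι R).submatrix f id * Z * B.submatrix id g := by
      ext i j
      simp [Matrix.mul_apply, Matrix.one_apply]
    rw [h, Matrix.det_mul, Matrix.det_mul]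
    exact Ideal.mem_span_singleton.2 ((dvd_mul_left _ _).mul_right _)
  · refine (Ideal.mul_unit_mem_iff_mem _ hg).1 (Ideal.subset_span ⟨id, g, ?_⟩)
    rw [← Matrix.det_mul]
    rfl

/-- The entries of `c` satisfy the linear relations whose coefficients are the rows of `A`. -/
def IsSolution [Fintype n] (A : Matrix m n R) {M : Type*} [AddCommGroup M] [Module R M]
    (c : n → M) : Prop :=
  ∀ i, ∑ j, A i j • c j = 0

variable [Fintype n] {A : Matrix m n R} {M N : Type*} [AddCommGroup M] [Module R M]
  [AddCommGroup N] [Module R N] {c : n → M}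

theorem isSolution_submatrix_equiv {n' : Type*} [Fintype n'] (e : n' ≃ n) :
    IsSolution (A.submatrix id e) (c ∘ e) ↔ IsSolution A c :=
  forall_congr' fun i => by rw [← e.sum_comp]; rfl

theorem IsSolution.map (h : IsSolution A c) (φ : M →ₗ[R] N) : IsSolution A (φ ∘ c) := fun i => by
  simpa using congrArg φ (h i)

theorem IsSolution.sub {c' : n → M} (h : IsSolution A c) (h' : IsSolution A c') :
    IsSolution A (c - c') := fun i => by
  simp [smul_sub, h i, h' i]

section UniversalSolution

variable [DecidableEq n]

/-- The universal solution of the relations with the matrix `A`. -/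
def universalSolution (A : Matrix m n R) (j : n) : (n → R) ⧸ Submodule.span R (Set.range A) :=
  Submodule.Quotient.mk (Pi.single j 1)

theorem sum_smul_universalSolution (A : Matrix m n R) (v : n → R) :
    ∑ j, v j • universalSolution A j = Submodule.Quotient.mk v := by
  simp only [universalSolution, ← Submodule.mkQ_apply, ← map_smul]
  rw [← map_sum, ← pi_eq_sum_univ' v]

theorem isSolution_universalSolution (A : Matrix m n R) : IsSolution A (universalSolution A) :=
  fun i => by
    rw [sum_smul_universalSolution, Submodule.Quotient.mk_eq_zero]
    exact Submodule.subset_span ⟨i, rfl⟩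

theorem IsSolution.exists_linearMap (h : IsSolution A c) :
    ∃ φ : ((n → R) ⧸ Submodule.span R (Set.range A)) →ₗ[R] M, φ ∘ universalSolution A = c := by
  refine ⟨Submodule.liftQ _ (Fintype.linearCombination R c) (Submodule.span_le.2 ?_), ?_⟩
  · rintro _ ⟨i, rfl⟩
    exact h i
  · ext j
    simp [universalSolution]

end UniversalSolution

theorem minorIdeal_le_of_isSolution [Finite m] {B : Matrix m' n R}
    (h : ∀ (M : Type (max u v)) [AddCommGroup M] [Module R M] (c : n → M),
      IsSolution A c → IsSolution B c) : minorIdeal ι B ≤ minorIdeal ι A := by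
  classical
  have := Fintype.ofFinite m
  have hB (i : m') : B i ∈ Submodule.span R (Set.range A) := by
    rw [← Submodule.Quotient.mk_eq_zero, ← sum_smul_universalSolution]
    exact h _ _ (isSolution_universalSolution A) i
  choose x hx using fun i => (Submodule.mem_span_range_iff_exists_fun R).1 (hB i)
  refine Ideal.span_le.2 ?_
  rintro _ ⟨f, g, rfl⟩
  have hdet : (B.submatrix f g).det =
      Matrix.detRowAlternating fun i => ∑ k, x (f i) k • fun j => A k (g j) := by
    refine congrArg Matrix.det (Matrix.ext fun i j => ?_)
    simp [← hx (f i)]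
  rw [hdet, ← AlternatingMap.coe_multilinearMap, MultilinearMap.map_sum]
  refine Ideal.sum_mem _ fun f' _ => ?_
  rw [MultilinearMap.map_smul_univ, smul_eq_mul]
  exact Ideal.mul_mem_left _ _ (Ideal.subset_span ⟨f', g, rfl⟩)

theorem isSolution_fromBlocks_iff [Fintype σ] [Fintype τ] [DecidableEq τ] {W : Matrix m σ R}
    {X : Matrix τ σ R} {c : σ ⊕ τ → M} :
    IsSolution (Matrix.fromBlocks W 0 (-X) 1) c ↔
      IsSolution W (c ∘ Sum.inl) ∧ ∀ j, c (Sum.inr j) = ∑ i, X j i • c (Sum.inl i) := by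
  simp [IsSolution, Sum.forall, Matrix.one_apply, ite_smul, neg_add_eq_zero, eq_comm (a := c _)]

/-- Restriction to the unknowns in `σ` is a bijection from the solutions of the relations `A` to the
solutions of the relations `W`. -/
structure IsElimination [Fintype σ] [Fintype τ] (A : Matrix m (σ ⊕ τ) R) (W : Matrix m' σ R) :
    Prop where
  restrict : ∀ (M : Type (max u v)) [AddCommGroup M] [Module R M] (c : σ ⊕ τ → M),
    IsSolution A c → IsSolution W (c ∘ Sum.inl)
  extend : ∀ (M : Type (max u v)) [AddCommGroup M] [Module R M] (v : σ → M),
    IsSolution W v → ∃ c, IsSolution A c ∧ c ∘ Sum.inl = v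
  eq_zero : ∀ (M : Type (max u v)) [AddCommGroup M] [Module R M] (c : σ ⊕ τ → M),
    IsSolution A c → c ∘ Sum.inl = 0 → c = 0

section Elimination

variable [Fintype σ] [Fintype τ] [DecidableEq τ] {A : Matrix m (σ ⊕ τ) R}

theorem IsElimination.exists_fromBlocks {W : Matrix m' σ R} (h : IsElimination A W) :
    ∃ X : Matrix τ σ R, ∀ (M : Type (max u v)) [AddCommGroup M] [Module R M] (c : σ ⊕ τ → M),
      IsSolution A c ↔ IsSolution (Matrix.fromBlocks W 0 (-X) 1) c := by
  classical
  -- `c₀` is a universal solution of `A` too, so the relations that it satisfies follow from `A`.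
  obtain ⟨c₀, hc₀, hinl⟩ := h.extend _ _ (isSolution_universalSolution W)
  obtain ⟨X, hX⟩ : ∃ X : Matrix τ σ R, ∀ j, c₀ (Sum.inr j) = ∑ i, X j i • c₀ (Sum.inl i) := by
    choose X hX using fun j => Submodule.Quotient.mk_surjective _ (c₀ (Sum.inr j))
    refine ⟨X, fun j => ?_⟩
    rw [← hX, ← sum_smul_universalSolution, ← hinl]
    rfl
  have hc₀' : IsSolution (Matrix.fromBlocks W 0 (-X) 1) c₀ :=
    isSolution_fromBlocks_iff.2 ⟨h.restrict _ _ hc₀, hX⟩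
  refine ⟨X, fun M _ _ c => ⟨fun hc => ?_, fun hc => ?_⟩⟩
  · obtain ⟨φ, hφ⟩ := (h.restrict M c hc).exists_linearMap
    have hφc : φ ∘ c₀ = c := sub_eq_zero.1 <| h.eq_zero M _ ((hc₀.map φ).sub hc) <| by
      rw [Pi.sub_comp, Function.comp_assoc, hinl, hφ, sub_self]
    exact hφc ▸ hc₀'.map φ
  · obtain ⟨h₁, h₂⟩ := isSolution_fromBlocks_iff.1 hc
    obtain ⟨φ, hφ⟩ := h₁.exists_linearMap
    rw [← hinl, ← Function.comp_assoc] at hφ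
    have hφc : φ ∘ c₀ = c := by
      ext (i | j)
      · exact congrFun hφ i
      · rw [h₂, (isSolution_fromBlocks_iff.1 (hc₀'.map φ)).2]
        exact Finset.sum_congr rfl fun i _ => congrArg (X j i • ·) (congrFun hφ i)
    exact hφc ▸ hc₀.map φ

theorem IsElimination.minorIdeal_eq [Finite m] {Y : Matrix ι ι R} {C : Matrix ι σ R}
    (h : IsElimination A (Y * C)) {g : ι → σ} (hg : IsUnit (C.submatrix id g).det) :
    minorIdeal (ι ⊕ τ) A = Ideal.span {Y.det} := by
  obtain ⟨X, hX⟩ := h.exists_fromBlocks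
  rw [le_antisymm (minorIdeal_le_of_isSolution fun M _ _ c => (hX M c).2)
    (minorIdeal_le_of_isSolution fun M _ _ c => (hX M c).1)]
  have hprod : Matrix.fromBlocks (Y * C) 0 (-X) (1 : Matrix τ τ R) =
      (Matrix.fromBlocks Y 0 0 1 : Matrix (ι ⊕ τ) (ι ⊕ τ) R) * Matrix.fromBlocks C 0 (-X) 1 := by
    simp [Matrix.fromBlocks_multiply]
  rw [hprod, minorIdeal_mul_eq_span_det _ _ (Sum.map g id)]
  · simp
  · have hcol : (Matrix.fromBlocks C 0 (-X) (1 : Matrix τ τ R)).submatrix id (Sum.map g id) =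
        Matrix.fromBlocks (C.submatrix id g) 0 (-X.submatrix id g) 1 := by
      ext (i | i) (j | j) <;> rfl
    simpa [hcol] using hg

end Elimination

end Minors

/-! ### Linear racks and coloured strands -/

/-- A rack structure on an abelian group `V` that is given by linear maps: a strand of colour `b`
that passes from the left to the right of an oriented strand of colour `a` gets the colour
`L a + T b`. -/
structure LinearRack (V : Type*) [AddCommGroup V] where
  T : V ≃+ V
  L : V →+ V
  L_T : ∀ x, L (T x) = T (L x)
  L_L : ∀ x, L (L x) = L x - T (L x)

variable {V : Type*} [AddCommGroup V]

namespace LinearRack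

variable (Q : LinearRack V)

theorem L_T_symm (x : V) : Q.L (Q.T.symm x) = Q.T.symm (Q.L x) := by
  rw [Q.T.eq_symm_apply, ← Q.L_T, Q.T.apply_symm_apply]

/-- The colour of the under-arc on the left in the plane of an over-arc with colour `a` and
orientation `d`, if the under-arc on the right has the colour `b`. -/
def under (a : V) (d : Bool) (b : V) : V :=
  if d then Q.T.symm (b - Q.L a) else Q.L a + Q.T b

/-- The coloured strands above the crossing `Letter.cross i o` of the coloured strands `x` and `y`,
from left to right. -/
def crossing : Bool → V × Bool → V × Bool → List (V × Bool)
  | true, x, y => [(Q.under x.1 x.2 y.1, y.2), x]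
  | false, x, y => [y, (Q.under y.1 (!y.2) x.1, x.2)]

/-- The action of a positive kink on the colours; it is trivial if the rack is a quandle. -/
def kink : Equiv.Perm V where
  toFun x := Q.T x + Q.L x
  invFun x := Q.T.symm (x - Q.L x)
  left_inv x := by simp [Q.L_T, Q.L_L]
  right_inv x := by simp [Q.L_L, Q.L_T_symm]

theorem kink_apply (x : V) : Q.kink x = Q.T x + Q.L x := rfl

theorem kink_inv_apply (x : V) : Q.kink⁻¹ x = Q.T.symm (x - Q.L x) := rfl

theorem L_kink (x : V) : Q.L (Q.kink x) = Q.L x := by simp [kink_apply, Q.L_T, Q.L_L]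

theorem L_kink_inv (x : V) : Q.L (Q.kink⁻¹ x) = Q.L x := by
  rw [← Q.L_kink, Equiv.Perm.inv_def, Equiv.apply_symm_apply]

theorem L_kink_zpow (k : ℤ) (x : V) : Q.L ((Q.kink ^ k) x) = Q.L x := by
  induction k with
  | zero => rfl
  | succ k ih => rw [add_comm, zpow_one_add, Equiv.Perm.mul_apply, L_kink, ih]
  | pred k ih => rw [sub_eq_neg_add, zpow_add, zpow_neg_one, Equiv.Perm.mul_apply, L_kink_inv, ih]

end LinearRack

/-- The word `w` leads from the coloured strands `s` to the coloured strands `t`, where `m` lists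
the left strands that arise at the successive local minima. -/
def IsTrace (Q : LinearRack V) :
    List Letter → List (V × Bool) → List (V × Bool) → List (V × Bool) → Prop
  | [], s, m, t => m = [] ∧ t = s
  | .cross i o :: w, s, m, t => ∃ x y r, s.drop i = x :: y :: r ∧
      IsTrace Q w (s.take i ++ (Q.crossing o x y ++ r)) m t
  | .cup i d :: w, s, m, t => i ≤ s.length ∧ ∃ a m', m = (a, d) :: m' ∧
      IsTrace Q w (s.take i ++ (a, d) :: (a, !d) :: s.drop i) m' t
  | .cap i :: w, s, m, t => ∃ x y r, s.drop i = x :: y :: r ∧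
      y = (x.1, !x.2) ∧ IsTrace Q w (s.take i ++ r) m t

/-- The word `w` can be put on top of strands with the orientations `l`. -/
inductive Composable : List Letter → List Bool → Prop
  | nil (l : List Bool) : Composable [] l
  | cross {w : List Letter} (o : Bool) (p r : List Bool) (d e : Bool) :
      Composable w (p ++ e :: d :: r) → Composable (.cross p.length o :: w) (p ++ d :: e :: r)
  | cup {w : List Letter} (p r : List Bool) (d : Bool) :
      Composable w (p ++ d :: (!d) :: r) → Composable (.cup p.length d :: w) (p ++ r)
  | cap {w : List Letter} (p r : List Bool) (d : Bool) :
      Composable w (p ++ r) → Composable (.cap p.length :: w) (p ++ d :: (!d) :: r)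

/-- The letter `l` with `k` further strands on its left. -/
def Letter.shift (k : ℕ) : Letter → Letter
  | .cross i o => .cross (k + i) o
  | .cup i d => .cup (k + i) d
  | .cap i => .cap (k + i)

section

variable {Q : LinearRack V} {w w₁ w₂ : List Letter} {s t u m p r : List (V × Bool)}
  {x y : V × Bool} {a b : V} {d e o : Bool}

theorem map_snd_crossing : (Q.crossing o x y).map Prod.snd = [y.2, x.2] := by
  cases o <;> rfl

theorem isTrace_cross_iff :
    IsTrace Q (.cross p.length o :: w) (p ++ x :: y :: r) m t ↔
      IsTrace Q w (p ++ (Q.crossing o x y ++ r)) m t := by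
  simp only [IsTrace, List.drop_left, List.take_left, exists_cons_cons_eq_and]

theorem isTrace_cup_iff :
    IsTrace Q (.cup p.length d :: w) (p ++ r) m t ↔
      ∃ a m', m = (a, d) :: m' ∧ IsTrace Q w (p ++ (a, d) :: (a, !d) :: r) m' t := by
  simp [IsTrace]

theorem isTrace_cap_iff :
    IsTrace Q (.cap p.length :: w) (p ++ (a, d) :: (b, e) :: r) m t ↔
      (b = a ∧ e = !d) ∧ IsTrace Q w (p ++ r) m t := by
  simp only [IsTrace, List.drop_left, List.take_left, exists_cons_cons_eq_and, Prod.mk.injEq]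

theorem isTrace_append :
    IsTrace Q (w₁ ++ w₂) s m u ↔
      ∃ m₁ m₂ t, m = m₁ ++ m₂ ∧ IsTrace Q w₁ s m₁ t ∧ IsTrace Q w₂ t m₂ u := by
  induction w₁ generalizing s m with
  | nil => simp [IsTrace, and_assoc]
  | cons l w ih =>
    cases l <;> simp only [List.cons_append, IsTrace, ih] <;> grind

theorem IsTrace.composable (h : IsTrace Q w s m t) : Composable w (s.map Prod.snd) := by
  induction w generalizing s m with
  | nil => exact .nil _
  | cons l w ih =>
    cases l with
    | cross i o =>
      obtain ⟨x, y, r, hs, h⟩ := h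
      obtain ⟨p, rfl, rfl⟩ := eq_append_of_drop_eq hs
      simpa using Composable.cross o (p.map Prod.snd) (r.map Prod.snd) x.2 y.2
        (by simpa [map_snd_crossing] using ih h)
    | cup i d =>
      obtain ⟨hi, a, m', -, h⟩ := h
      have := Composable.cup ((s.take i).map Prod.snd) ((s.drop i).map Prod.snd) d
        (by simpa using ih h)
      simpa [← List.map_append, hi] using this
    | cap i =>
      obtain ⟨x, _, r, hs, rfl, h⟩ := h
      obtain ⟨p, rfl, rfl⟩ := eq_append_of_drop_eq hs
      simpa using Composable.cap (p.map Prod.snd) (r.map Prod.snd) x.2 (by simpa using ih h)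

theorem IsTrace.map_zero (h : IsTrace Q w s m t) :
    IsTrace Q w (s.map (Prod.map 0 id)) (m.map (Prod.map 0 id)) (t.map (Prod.map 0 id)) := by
  induction w generalizing s m with
  | nil =>
    obtain ⟨rfl, rfl⟩ := h
    exact ⟨rfl, rfl⟩
  | cons l w ih =>
    cases l with
    | cross i o =>
      obtain ⟨x, y, r, hs, h⟩ := h
      refine ⟨_, _, _, by rw [← List.map_drop, hs]; rfl, ?_⟩
      convert ih h
      cases o <;> simp [LinearRack.crossing, LinearRack.under]
    | cup i d =>
      obtain ⟨hi, a, m', rfl, h⟩ := h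
      exact ⟨by simpa using hi, 0, _, rfl, by simpa using ih h⟩
    | cap i =>
      obtain ⟨x, _, r, hs, rfl, h⟩ := h
      exact ⟨_, _, _, by rw [← List.map_drop, hs]; rfl, rfl, by simpa using ih h⟩

end

/-- The only strands to which the word `w` leads from the coloured strands `s` are `t`, and the
colours of the local minima are determined. -/
def UniqueTrace (Q : LinearRack V) (w : List Letter) (s t : List (V × Bool)) : Prop :=
  ∃ m, ∀ m' t', IsTrace Q w s m' t' ↔ m' = m ∧ t' = t

section

variable {Q : LinearRack V} {w w₁ w₂ : List Letter} {s t u m p r : List (V × Bool)}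

theorem UniqueTrace.composable (h : UniqueTrace Q w s t) : Composable w (s.map Prod.snd) :=
  let ⟨m, hm⟩ := h
  ((hm m t).2 ⟨rfl, rfl⟩).composable

theorem UniqueTrace.isTrace_append_iff (h : UniqueTrace Q w₁ s t) :
    ∃ m₁, ∀ m u, IsTrace Q (w₁ ++ w₂) s m u ↔ ∃ m₂, m = m₁ ++ m₂ ∧ IsTrace Q w₂ t m₂ u := by
  obtain ⟨m₁, h⟩ := h
  exact ⟨m₁, fun m u => by simp [isTrace_append, h]⟩

theorem UniqueTrace.append (h₁ : UniqueTrace Q w₁ s t) (h₂ : UniqueTrace Q w₂ t u) :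
    UniqueTrace Q (w₁ ++ w₂) s u := by
  obtain ⟨m₁, h₁⟩ := h₁.isTrace_append_iff (w₂ := w₂)
  obtain ⟨m₂, h₂⟩ := h₂
  exact ⟨m₁ ++ m₂, fun m v => by rw [h₁]; simp [h₂]⟩

theorem uniqueTrace_nil (Q : LinearRack V) (s : List (V × Bool)) : UniqueTrace Q [] s s :=
  ⟨[], fun _ _ => Iff.rfl⟩

theorem uniqueTrace_cross (Q : LinearRack V) (o : Bool) (p : List (V × Bool)) (x y : V × Bool)
    (r : List (V × Bool)) :
    UniqueTrace Q [.cross p.length o] (p ++ x :: y :: r) (p ++ (Q.crossing o x y ++ r)) :=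
  ⟨[], fun _ _ => isTrace_cross_iff⟩

theorem connectedSum_succ (k : ℕ) (w : List Letter) :
    connectedSum (k + 1) w = w ++ connectedSum k w := by
  simp [connectedSum, List.replicate_succ]

theorem UniqueTrace.connectedSum {α : Type*} {f : α → List (V × Bool)} {F : α → α}
    (h : ∀ a, UniqueTrace Q w (f a) (f (F a))) (k : ℕ) (a : α) :
    UniqueTrace Q (connectedSum k w) (f a) (f (F^[k] a)) := by
  induction k generalizing a with
  | zero => exact uniqueTrace_nil Q _
  | succ k ih => rw [connectedSum_succ]; exact (h a).append (ih (F a))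

theorem isTrace_shift_iff (h : Composable w (s.map Prod.snd)) :
    IsTrace Q (w.map (.shift p.length)) (p ++ (s ++ r)) m u ↔
      ∃ t, u = p ++ (t ++ r) ∧ IsTrace Q w s m t := by
  generalize hl : s.map Prod.snd = l at h
  induction h generalizing s m with
  | nil => simp only [List.map_nil, IsTrace]; grind
  | @cross w o q l d e _ ih =>
    obtain ⟨q, ⟨a, d⟩, ⟨b, e⟩, l, rfl, rfl, rfl, rfl, rfl⟩ :=
      exists_of_map_eq_append_cons_cons hl
    have ih := @ih (q ++ (Q.crossing o (a, d) (b, e) ++ l)) m (by simp [map_snd_crossing])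
    have := @isTrace_cross_iff (p := p ++ q)
    simp only [List.append_assoc, List.length_append] at ih this
    simp only [List.map_cons, Letter.shift, List.length_map, List.append_assoc, List.cons_append,
      isTrace_cross_iff, this, ih]
  | @cup w q l d _ ih =>
    obtain ⟨q, l, rfl, rfl, rfl⟩ := List.map_eq_append_iff.1 hl
    have ih a m := @ih (q ++ (a, d) :: (a, !d) :: l) m (by simp)
    have := @isTrace_cup_iff (p := p ++ q)
    simp only [List.append_assoc, List.length_append, List.cons_append] at ih this
    simp only [List.map_cons, Letter.shift, List.length_map, List.append_assoc, isTrace_cup_iff,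
      this, ih]
    grind
  | @cap w q l d _ ih =>
    obtain ⟨q, ⟨a, d⟩, ⟨b, _⟩, l, rfl, rfl, rfl, rfl, rfl⟩ :=
      exists_of_map_eq_append_cons_cons hl
    have ih := @ih (q ++ l) m (by simp)
    have := @isTrace_cap_iff (p := p ++ q)
    simp only [List.append_assoc, List.length_append] at ih this
    simp only [List.map_cons, Letter.shift, List.length_map, List.append_assoc, List.cons_append,
      isTrace_cap_iff, this, ih]
    grind

theorem UniqueTrace.shift (h : UniqueTrace Q w s t) (p r : List (V × Bool)) :
    UniqueTrace Q (w.map (.shift p.length)) (p ++ (s ++ r)) (p ++ (t ++ r)) := by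
  have hw := h.composable
  obtain ⟨m, h⟩ := h
  exact ⟨m, fun m' u => by simp only [isTrace_shift_iff hw, h]; grind⟩

end

/-! ### Doubles -/

/-- The linear rack by which a diagram is coloured if its double, in the sense of `doubleLetter`, is
coloured by `Q`: a strand is coloured by the colours of its two copies, the copy on its left
first. -/
def LinearRack.double (Q : LinearRack V) : Bool → LinearRack (V × V)
  | true =>
    let l := (Q.T.toAddMonoidHom.comp Q.L).comp (.fst V V) + Q.L.comp (.snd V V)
    { T := (Q.T.trans Q.T).prodCongr (Q.T.trans Q.T)
      L := l.prod l
      L_T := fun x => by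
        change (Q.T (Q.L (Q.T (Q.T x.1))) + Q.L (Q.T (Q.T x.2)),
          Q.T (Q.L (Q.T (Q.T x.1))) + Q.L (Q.T (Q.T x.2))) = (Q.T (Q.T _), Q.T (Q.T _))
        simp [l, Q.L_T]
      L_L := fun x => by
        change _ = _ - (Q.T (Q.T _), Q.T (Q.T _))
        ext <;>
          simp only [l, AddEquiv.toAddMonoidHom_eq_coe, AddMonoidHom.prod_apply,
            AddMonoidHom.add_apply, AddMonoidHom.coe_comp, AddMonoidHom.coe_coe,
            AddMonoidHom.coe_fst, AddMonoidHom.coe_snd, Function.comp_apply,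
            ZeroHom.toFun_eq_coe, AddMonoidHom.toZeroHom_coe, Prod.mk_sub_mk, map_add, map_sub,
            Q.L_T, Q.L_L] <;>
          abel }
  | false =>
    let l := (Q.T.symm.toAddMonoidHom.comp Q.L).comp (.fst V V - .snd V V)
    { T := .refl _
      L := l.prod l
      L_T := fun x => rfl
      L_L := fun x => by simp [l] }

/-- The strands of the double of a diagram with the strands `s`. -/
def flat {α : Type*} (par : Bool) (s : List ((α × α) × Bool)) : List (α × Bool) :=
  s.flatMap fun x =>
    if x.2 then [(x.1.1, true), (x.1.2, par)] else [(x.1.2, !par), (x.1.1, false)]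

section

variable {Q : LinearRack V} {par : Bool} {x y : (V × V) × Bool} {a b : V × V} {d o : Bool}
  {w : List Letter} {s : List ((V × V) × Bool)} {m t : List (V × Bool)}

theorem double_true_under_true : (Q.double true).under a true b =
    (Q.under a.1 true (Q.under a.2 true b.1), Q.under a.1 true (Q.under a.2 true b.2)) := by
  change (Q.T.symm (Q.T.symm (b.1 - (Q.T (Q.L a.1) + Q.L a.2))),
    Q.T.symm (Q.T.symm (b.2 - (Q.T (Q.L a.1) + Q.L a.2)))) = _
  simp [LinearRack.under, sub_sub, add_comm]

theorem double_true_under_false : (Q.double true).under a false b =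
    (Q.under a.2 false (Q.under a.1 false b.1), Q.under a.2 false (Q.under a.1 false b.2)) := by
  change (Q.T (Q.L a.1) + Q.L a.2 + Q.T (Q.T b.1), Q.T (Q.L a.1) + Q.L a.2 + Q.T (Q.T b.2)) = _
  simp [LinearRack.under, add_assoc, add_left_comm]

theorem double_false_under_true : (Q.double false).under a true b =
    (Q.under a.1 true (Q.under a.2 false b.1), Q.under a.1 true (Q.under a.2 false b.2)) := by
  change (b.1 - Q.T.symm (Q.L (a.1 - a.2)), b.2 - Q.T.symm (Q.L (a.1 - a.2))) = _
  ext <;> simp only [LinearRack.under, if_true, if_false, Bool.false_eq_true, map_add, map_sub,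
    AddEquiv.symm_apply_apply] <;> abel

theorem double_false_under_false : (Q.double false).under a false b =
    (Q.under a.2 true (Q.under a.1 false b.1), Q.under a.2 true (Q.under a.1 false b.2)) := by
  change (Q.T.symm (Q.L (a.1 - a.2)) + b.1, Q.T.symm (Q.L (a.1 - a.2)) + b.2) = _
  ext <;> simp only [LinearRack.under, if_true, if_false, Bool.false_eq_true, map_add, map_sub,
    AddEquiv.symm_apply_apply] <;> abel

theorem flat_append {α : Type*} (par : Bool) (s t : List ((α × α) × Bool)) :
    flat par (s ++ t) = flat par s ++ flat par t :=
  List.flatMap_append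

theorem length_flat {α : Type*} (par : Bool) (s : List ((α × α) × Bool)) :
    (flat par s).length = 2 * s.length := by
  have h : (fun x : (α × α) × Bool => (if x.2 then [(x.1.1, true), (x.1.2, par)]
      else [(x.1.2, !par), (x.1.1, false)]).length) = fun _ => 2 := by
    ext x
    split <;> rfl
  simp [flat, List.length_flatMap, h, mul_comm]

theorem doubleLetter_shift (par : Bool) (k : ℕ) (l : Letter) :
    doubleLetter par (l.shift k) = (doubleLetter par l).map (.shift (2 * k)) := by
  rcases l with _ | _ | _ <;> cases par <;>
    simp [doubleLetter, Letter.shift, mul_add, add_assoc]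

theorem isTrace_doubleLetter_cross_iff :
    IsTrace Q (doubleLetter par (.cross 0 o)) (flat par [x, y]) m t ↔
      m = [] ∧ t = flat par ((Q.double par).crossing o x y) := by
  obtain ⟨⟨x₁, x₂⟩, d⟩ := x
  obtain ⟨⟨y₁, y₂⟩, e⟩ := y
  cases par <;> cases o <;> cases d <;> cases e <;>
    simp only [doubleLetter, IsTrace, flat, LinearRack.crossing, exists_cons_cons_eq_and,
      List.drop_succ_cons, List.drop_zero, List.take_succ_cons, List.take_zero, List.cons_append,
      List.nil_append, List.flatMap_cons, List.flatMap_nil, if_true, if_false, Bool.false_eq_true,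
      Bool.not_true, Bool.not_false, mul_zero, zero_add, double_true_under_true,
      double_true_under_false, double_false_under_true, double_false_under_false]

theorem isTrace_doubleLetter_cup_iff :
    IsTrace Q (doubleLetter par (.cup 0 d)) [] m t ↔
      ∃ a, m = flat par [(a, d)] ∧ t = flat par [(a, d), (a, !d)] := by
  cases par <;> cases d <;>
    simp only [doubleLetter, IsTrace, flat, List.length_nil, List.length_cons, List.take_succ_cons,
      List.take_zero, List.take_nil, List.drop_succ_cons, List.drop_zero, List.drop_nil,
      List.cons_append, List.nil_append, List.flatMap_cons, List.flatMap_nil, if_true, if_false,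
      Bool.false_eq_true, Bool.not_true, Bool.not_false, mul_zero, zero_add, Prod.exists] <;>
    grind

theorem isTrace_doubleLetter_cap_iff :
    IsTrace Q (doubleLetter par (.cap 0)) (flat par [(a, d), (b, !d)]) m t ↔
      b = a ∧ m = [] ∧ t = [] := by
  obtain ⟨a₁, a₂⟩ := a
  obtain ⟨b₁, b₂⟩ := b
  cases par <;> cases d <;>
    simp only [doubleLetter, IsTrace, flat, exists_cons_cons_eq_and, List.take_succ_cons,
      List.take_zero, List.drop_succ_cons, List.drop_zero, List.cons_append, List.nil_append,
      List.flatMap_cons, List.flatMap_nil, if_true, if_false, Bool.false_eq_true, Bool.not_true,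
      Bool.not_false, mul_zero, zero_add] <;>
    grind

theorem isTrace_doubleLetter_shift_append_iff {l : Letter} {q r : List ((V × V) × Bool)}
    (h : Composable (doubleLetter par l) ((flat par s).map Prod.snd)) {u : List (V × Bool)}
    {w : List Letter} :
    IsTrace Q (doubleLetter par (l.shift q.length) ++ w) (flat par (q ++ (s ++ r))) m u ↔
      ∃ m₁ m₂ t, m = m₁ ++ m₂ ∧ IsTrace Q (doubleLetter par l) (flat par s) m₁ t ∧
        IsTrace Q w (flat par q ++ (t ++ flat par r)) m₂ u := by
  rw [doubleLetter_shift, ← length_flat par, flat_append, flat_append, isTrace_append]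
  simp only [isTrace_shift_iff h]
  grind

variable {q r : List ((V × V) × Bool)}

theorem isTrace_flatMap_cross_iff :
    IsTrace Q ((Letter.cross q.length o :: w).flatMap (doubleLetter par))
        (flat par (q ++ x :: y :: r)) m t ↔
      IsTrace Q (w.flatMap (doubleLetter par))
        (flat par (q ++ ((Q.double par).crossing o x y ++ r))) m t := by
  have hc : Composable (doubleLetter par (.cross 0 o)) ((flat par [x, y]).map Prod.snd) :=
    (isTrace_doubleLetter_cross_iff (Q := Q) |>.2 ⟨rfl, rfl⟩).composable
  simpa [isTrace_doubleLetter_cross_iff, Letter.shift, flat_append] using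
    isTrace_doubleLetter_shift_append_iff (Q := Q) hc (q := q) (r := r) (m := m) (u := t)
      (w := w.flatMap (doubleLetter par))

theorem isTrace_flatMap_cup_iff :
    IsTrace Q ((Letter.cup q.length d :: w).flatMap (doubleLetter par)) (flat par (q ++ r)) m t ↔
      ∃ m' a, m = flat par [(a, d)] ++ m' ∧ IsTrace Q (w.flatMap (doubleLetter par))
        (flat par (q ++ (a, d) :: (a, !d) :: r)) m' t := by
  have hc : Composable (doubleLetter par (.cup 0 d)) ((flat par []).map Prod.snd) :=
    (isTrace_doubleLetter_cup_iff (Q := Q) |>.2 ⟨0, rfl, rfl⟩).composable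
  simpa [isTrace_doubleLetter_cup_iff, Letter.shift, flat] using
    isTrace_doubleLetter_shift_append_iff (Q := Q) hc (q := q) (r := r) (m := m) (u := t)
      (w := w.flatMap (doubleLetter par))

theorem isTrace_flatMap_cap_iff :
    IsTrace Q ((Letter.cap q.length :: w).flatMap (doubleLetter par))
        (flat par (q ++ (a, d) :: (b, !d) :: r)) m t ↔
      b = a ∧ IsTrace Q (w.flatMap (doubleLetter par)) (flat par (q ++ r)) m t := by
  have hc : Composable (doubleLetter par (.cap 0)) ((flat par [(a, d), (b, !d)]).map Prod.snd) := by
    convert (isTrace_doubleLetter_cap_iff (Q := Q) (a := a) (d := d)).2 ⟨rfl, rfl, rfl⟩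
      |>.composable using 1
    cases par <;> cases d <;> rfl
  simpa [isTrace_doubleLetter_cap_iff, Letter.shift, flat_append] using
    isTrace_doubleLetter_shift_append_iff (Q := Q) hc (q := q) (r := r) (m := m) (u := t)
      (w := w.flatMap (doubleLetter par))

theorem isTrace_flatMap_doubleLetter_iff (h : Composable w (s.map Prod.snd)) :
    IsTrace Q (w.flatMap (doubleLetter par)) (flat par s) m t ↔
      ∃ m' t', m = flat par m' ∧ t = flat par t' ∧ IsTrace (Q.double par) w s m' t' := by
  generalize hl : s.map Prod.snd = l at h
  induction h generalizing s m with
  | nil =>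
    constructor
    · rintro ⟨rfl, rfl⟩
      exact ⟨[], s, rfl, rfl, rfl, rfl⟩
    · rintro ⟨_, _, rfl, rfl, rfl, rfl⟩
      exact ⟨rfl, rfl⟩
  | @cross _ _ _ _ _ _ _ ih =>
    obtain ⟨q, ⟨a, d⟩, ⟨b, e⟩, r, rfl, rfl, rfl, rfl, rfl⟩ :=
      exists_of_map_eq_append_cons_cons hl
    simp only [List.length_map, isTrace_flatMap_cross_iff, isTrace_cross_iff]
    exact ih (by simp [map_snd_crossing])
  | @cup w _ _ d _ ih =>
    obtain ⟨q, r, rfl, rfl, rfl⟩ := List.map_eq_append_iff.1 hl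
    have ih a m := @ih (q ++ (a, d) :: (a, !d) :: r) m (by simp)
    simp only [List.length_map, isTrace_flatMap_cup_iff, isTrace_cup_iff, ih]
    constructor
    · rintro ⟨_, a, rfl, m', t', rfl, rfl, h⟩
      exact ⟨(a, d) :: m', t', (flat_append par [(a, d)] m').symm, rfl, a, m', rfl, h⟩
    · rintro ⟨_, t', rfl, rfl, a, m', rfl, h⟩
      exact ⟨flat par m', a, flat_append par [(a, d)] m', m', t', rfl, rfl, h⟩
  | @cap w _ _ d _ ih =>
    obtain ⟨q, ⟨a, d⟩, ⟨b, _⟩, r, rfl, rfl, rfl, rfl, rfl⟩ :=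
      exists_of_map_eq_append_cons_cons hl
    simp only [List.length_map, isTrace_flatMap_cap_iff, isTrace_cap_iff, and_true,
      @ih (q ++ r) m (by simp)]
    grind

theorem UniqueTrace.double {s t : List ((V × V) × Bool)} (h : UniqueTrace (Q.double par) w s t) :
    UniqueTrace Q (w.flatMap (doubleLetter par)) (flat par s) (flat par t) := by
  have hw := h.composable
  obtain ⟨m, h⟩ := h
  exact ⟨flat par m, fun m' t' => by simp [isTrace_flatMap_doubleLetter_iff hw, h]⟩

end

/-! ### Colourings of diagrams -/

namespace Diagram

/-- The diagram `D` whose strands `x` and `y`, between `p` and `r`, cross as in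
`Letter.cross p.length o`. -/
def cross (D : Diagram) (o : Bool) (p : List (ℕ × Bool)) (x y : ℕ × Bool) (r : List (ℕ × Bool)) :
    Diagram where
  strands := p ++ ((if o then [(D.arcs, y.2), x] else [y, (D.arcs, x.2)]) ++ r)
  arcs := D.arcs + 1
  crossings := D.crossings ++
    [if o then (if x.2 then (x.1, D.arcs, y.1) else (x.1, y.1, D.arcs))
      else if y.2 then (y.1, x.1, D.arcs) else (y.1, D.arcs, x.1)]
  joins := D.joins
  writhe := D.writhe + crossingSign o x.2 y.2

/-- The letter `l` fits on top of the diagram `D`, with the result `D'`. -/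
inductive IsStep (D : Diagram) : Letter → Diagram → Prop
  | cross {p r : List (ℕ × Bool)} {x y : ℕ × Bool} (o : Bool) (h : D.strands = p ++ x :: y :: r) :
      IsStep D (.cross p.length o) (D.cross o p x y r)
  | cup {p r : List (ℕ × Bool)} (d : Bool) (h : D.strands = p ++ r) :
      IsStep D (.cup p.length d)
        { D with strands := p ++ (D.arcs, d) :: (D.arcs, !d) :: r, arcs := D.arcs + 1 }
  | cap {p r : List (ℕ × Bool)} {a b : ℕ} {d : Bool}
      (h : D.strands = p ++ (a, d) :: (b, !d) :: r) :
      IsStep D (.cap p.length) { D with strands := p ++ r, joins := D.joins ++ [(a, b)] }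

/-- A colouring of the arcs of a diagram by a linear rack. -/
def IsColoring (Q : LinearRack V) (D : Diagram) (c : ℕ → V) : Prop :=
  (∀ x ∈ D.crossings, c x.2.2 = Q.L (c x.1) + Q.T (c x.2.1)) ∧ ∀ x ∈ D.joins, c x.1 = c x.2

/-- The coloured strands at the top of a diagram. -/
def top (D : Diagram) (c : ℕ → V) : List (V × Bool) :=
  D.strands.map (Prod.map c id)

/-- All arcs that occur in the diagram have numbers less than `arcs`. -/
structure WellFormed (D : Diagram) : Prop where
  strands : ∀ p ∈ D.strands, p.1 < D.arcs
  crossings : ∀ x ∈ D.crossings, x.1 < D.arcs ∧ x.2.1 < D.arcs ∧ x.2.2 < D.arcs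
  joins : ∀ x ∈ D.joins, x.1 < D.arcs ∧ x.2 < D.arcs

section

variable {D D' : Diagram} {Q : LinearRack V} {c : ℕ → V} {w w' : List Letter} {l : Letter}
  {p r : List (ℕ × Bool)} {x y : ℕ × Bool} {o : Bool} {m t : List (V × Bool)}

theorem run_cons : D.run (l :: w) = (D.step l).bind fun D' => D'.run w := rfl

theorem run_append : D.run (w ++ w') = (D.run w).bind fun D' => D'.run w' :=
  List.foldlM_append

theorem step_eq_some_iff : D.step l = some D' ↔ D.IsStep l D' := by
  constructor
  · intro h
    rcases l with ⟨i, o⟩ | ⟨i, d⟩ | i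
    · obtain ⟨x, y, r, hd⟩ : ∃ x y r, D.strands.drop i = x :: y :: r := by
        cases o <;> simp only [Diagram.step] at h <;> split at h <;> simp_all
      obtain ⟨p, rfl, hs⟩ := eq_append_of_drop_eq hd
      obtain rfl : D.cross o p x y r = D' := by
        cases o <;> simpa [Diagram.step, hs, cross] using h
      exact .cross o hs
    · obtain ⟨hi, h⟩ : i ≤ D.strands.length ∧ _ = D' := by simpa [Diagram.step] using h
      have := IsStep.cup d (List.take_append_drop i D.strands).symm
      rwa [List.length_take_of_le hi, h] at this
    · simp only [Diagram.step] at h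
      split at h
      · rename_i a d b e r hd
        obtain ⟨p, rfl, hs⟩ := eq_append_of_drop_eq hd
        obtain ⟨hde, rfl⟩ : ¬d = e ∧ _ = D' := by simpa [hs] using h
        obtain rfl : e = !d := by cases d <;> simpa using hde
        exact .cap hs
      · simp at h
  · rintro (⟨o, h⟩ | ⟨d, h⟩ | h)
    · cases o <;> simp [Diagram.step, h, cross]
    · simp [Diagram.step, h]
    · simp [Diagram.step, h]

theorem isColoring_cross_iff : (D.cross o p x y r).IsColoring Q c ↔ D.IsColoring Q c ∧
    (if o then [(D.arcs, y.2), x] else [y, (D.arcs, x.2)]).map (Prod.map c id) =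
      Q.crossing o (Prod.map c id x) (Prod.map c id y) := by
  obtain ⟨a, d⟩ := x
  obtain ⟨b, e⟩ := y
  have hT (u v : V) : Q.T.symm u - Q.T.symm v = c D.arcs ↔ u = v + Q.T (c D.arcs) := by
    rw [← map_sub, Q.T.symm_apply_eq, sub_eq_iff_eq_add']
  cases o <;> cases d <;> cases e <;>
    simp [IsColoring, cross, LinearRack.crossing, LinearRack.under, or_imp, forall_and,
      hT, and_right_comm, eq_comm (a := c D.arcs)]

theorem IsStep.arcs_le (h : D.IsStep l D') : D.arcs ≤ D'.arcs := by
  cases h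
  exacts [Nat.le_succ _, Nat.le_succ _, le_rfl]

theorem IsStep.wellFormed (h : D.IsStep l D') (hD : D.WellFormed) : D'.WellFormed := by
  obtain ⟨hs, hc, hj⟩ := hD
  rcases h with ⟨o, h⟩ | ⟨d, h⟩ | h <;>
    simp only [h, List.forall_mem_append, List.forall_mem_cons] at hs
  · refine ⟨?_, ?_, fun x hx => ⟨(hj x hx).1.trans (Nat.lt_succ_self _),
      (hj x hx).2.trans (Nat.lt_succ_self _)⟩⟩ <;>
    cases o <;> simp only [Diagram.cross, if_true, if_false, Bool.false_eq_true,
      List.forall_mem_append, List.forall_mem_cons] <;> grind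
  · constructor <;> grind
  · constructor <;> grind

theorem IsStep.isColoring (h : D.IsStep l D') (hc : D'.IsColoring Q c) : D.IsColoring Q c := by
  rcases h with ⟨o, h⟩ | ⟨d, h⟩ | h
  · exact (isColoring_cross_iff.1 hc).1
  · exact hc
  · exact ⟨hc.1, fun x hx => hc.2 x (List.mem_append_left _ hx)⟩

theorem run_cons_eq_some_iff :
    D.run (l :: w) = some D' ↔ ∃ D₁, D.IsStep l D₁ ∧ D₁.run w = some D' := by
  simp only [run_cons, Option.bind_eq_some_iff, step_eq_some_iff]

theorem WellFormed.of_run (hD : D.WellFormed) (h : D.run w = some D') : D'.WellFormed := by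
  induction w generalizing D with
  | nil => cases h; exact hD
  | cons l w ih =>
    obtain ⟨D₁, h₁, h⟩ := run_cons_eq_some_iff.1 h
    exact ih (h₁.wellFormed hD) h

theorem arcs_le_of_run (h : D.run w = some D') : D.arcs ≤ D'.arcs := by
  induction w generalizing D with
  | nil => cases h; exact le_rfl
  | cons l w ih =>
    obtain ⟨D₁, h₁, h⟩ := run_cons_eq_some_iff.1 h
    exact h₁.arcs_le.trans (ih h)

theorem IsColoring.of_run (hc : D'.IsColoring Q c) (h : D.run w = some D') : D.IsColoring Q c := by
  induction w generalizing D with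
  | nil => cases h; exact hc
  | cons l w ih =>
    obtain ⟨D₁, h₁, h⟩ := run_cons_eq_some_iff.1 h
    exact h₁.isColoring (ih h)

theorem IsStep.exists_isTrace (h : D.IsStep l D') (hD : D.WellFormed) (hc : D'.IsColoring Q c) :
    ∃ m, IsTrace Q [l] (D.top c) m (D'.top c) ∧
      ((∀ a < D.arcs, c a = 0) → (∀ x ∈ m, x.1 = 0) → ∀ a < D'.arcs, c a = 0) := by
  rcases h with ⟨o, h⟩ | ⟨d, h⟩ | h
  · rename_i p r x y
    have hs := hD.strands
    obtain ⟨-, hn⟩ := isColoring_cross_iff.1 hc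
    simp only [h, List.forall_mem_append, List.forall_mem_cons] at hs
    refine ⟨[], ?_, fun h₀ _ a ha => ?_⟩
    · have ht : (D.cross o p x y r).top c = p.map (Prod.map c id) ++
          (Q.crossing o (Prod.map c id x) (Prod.map c id y) ++ r.map (Prod.map c id)) := by
        rw [← hn]
        simp only [top, Diagram.cross, List.map_append]
      rw [ht, top, h, List.map_append, List.map_cons, List.map_cons,
        ← List.length_map (Prod.map c id)]
      exact isTrace_cross_iff.2 ⟨rfl, rfl⟩
    · obtain ha | rfl := Nat.lt_succ_iff_lt_or_eq.1 ha
      · exact h₀ a ha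
      · cases o <;> simp [LinearRack.crossing, LinearRack.under, h₀ _ hs.2.1, h₀ _ hs.2.2.1] at hn
        all_goals simpa using hn
  · refine ⟨[(c D.arcs, d)], ?_, ?_⟩
    · simp [IsTrace, top, h]
    · simp only [Nat.lt_succ_iff_lt_or_eq, List.forall_mem_singleton]
      grind
  · refine ⟨[], ?_, fun h₀ _ => h₀⟩
    have := hc.2
    simp_all [IsTrace, top, or_imp, forall_and]

theorem exists_isTrace_of_run (h : D.run w = some D') (hD : D.WellFormed)
    (hc : D'.IsColoring Q c) :
    ∃ m, IsTrace Q w (D.top c) m (D'.top c) ∧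
      ((∀ a < D.arcs, c a = 0) → (∀ x ∈ m, x.1 = 0) → ∀ a < D'.arcs, c a = 0) := by
  induction w generalizing D with
  | nil =>
    cases h
    exact ⟨[], ⟨rfl, rfl⟩, fun h₀ _ => h₀⟩
  | cons l w ih =>
    obtain ⟨D₁, h₁, h⟩ := run_cons_eq_some_iff.1 h
    obtain ⟨m₁, ht₁, hm₁⟩ := h₁.exists_isTrace hD (hc.of_run h)
    obtain ⟨m₂, ht₂, hm₂⟩ := ih h (h₁.wellFormed hD)
    refine ⟨m₁ ++ m₂, isTrace_append (w₁ := [l]).2 ⟨m₁, m₂, _, rfl, ht₁, ht₂⟩, fun h₀ hm => ?_⟩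
    rw [List.forall_mem_append] at hm
    exact hm₂ (hm₁ h₀ hm.1) hm.2

theorem WellFormed.map_update_strands {α : Type*} (hD : D.WellFormed) (c : ℕ → α) (v : α) :
    ∀ q ∈ D.strands, Prod.map (Function.update c D.arcs v) id q = Prod.map c id q :=
  fun q hq => by rw [Prod.map, Function.update_of_ne (hD.strands q hq).ne, Prod.map]

theorem WellFormed.isColoring_update (hD : D.WellFormed) (hc : D.IsColoring Q c) (v : V) :
    D.IsColoring Q (Function.update c D.arcs v) := by
  refine ⟨fun x hx => ?_, fun x hx => ?_⟩
  · obtain ⟨h₁, h₂, h₃⟩ := hD.crossings x hx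
    simpa [h₁.ne, h₂.ne, h₃.ne] using hc.1 x hx
  · obtain ⟨h₁, h₂⟩ := hD.joins x hx
    simpa [h₁.ne, h₂.ne] using hc.2 x hx

theorem WellFormed.exists_isColoring_cross (hD : D.WellFormed) (hc : D.IsColoring Q c)
    (h : D.strands = p ++ x :: y :: r) : ∃ v, (D.cross o p x y r).IsColoring Q
      (Function.update c D.arcs v) ∧ (D.cross o p x y r).top (Function.update c D.arcs v) =
        p.map (Prod.map c id) ++ (Q.crossing o (Prod.map c id x) (Prod.map c id y) ++
          r.map (Prod.map c id)) := by
  obtain ⟨v, hv⟩ : ∃ v, Q.crossing o (Prod.map c id x) (Prod.map c id y) =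
      if o then [(v, y.2), Prod.map c id x] else [Prod.map c id y, (v, x.2)] := by
    cases o <;> exact ⟨_, rfl⟩
  have hs := hD.map_update_strands c v
  simp only [h, List.forall_mem_append, List.forall_mem_cons] at hs
  obtain ⟨hp, hx, hy, hr⟩ := hs
  have hnew : (if o then [(D.arcs, y.2), x] else [y, (D.arcs, x.2)]).map
      (Prod.map (Function.update c D.arcs v) id) =
        Q.crossing o (Prod.map c id x) (Prod.map c id y) := by
    rw [hv]
    cases o <;> simp [hx, hy]
  refine ⟨v, isColoring_cross_iff.2 ⟨hD.isColoring_update hc v, by rw [hnew, hx, hy]⟩, ?_⟩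
  simp only [top, cross, List.map_append, hnew, List.map_congr_left hp, List.map_congr_left hr]

theorem WellFormed.exists_isStep (hD : D.WellFormed) (hc : D.IsColoring Q c)
    (h : IsTrace Q (l :: w) (D.top c) m t) :
    ∃ D₁ c₁ m₁, D.IsStep l D₁ ∧ (∀ a < D.arcs, c₁ a = c a) ∧ D₁.IsColoring Q c₁ ∧
      IsTrace Q w (D₁.top c₁) m₁ t := by
  have hn (v : V) : ∀ a < D.arcs, Function.update c D.arcs v a = c a :=
    fun a ha => Function.update_of_ne ha.ne _ _
  cases l with
  | cross i o =>
    obtain ⟨_, _, _, hs, h⟩ := h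
    obtain ⟨_, rfl, hs'⟩ := eq_append_of_drop_eq hs
    obtain ⟨p, x, y, r, hD', rfl, rfl, rfl, rfl⟩ :=
      exists_of_map_eq_append_cons_cons hs'
    obtain ⟨v, hv, ht⟩ := hD.exists_isColoring_cross (o := o) hc hD'
    refine ⟨_, _, m, by rw [List.length_map]; exact .cross o hD', hn v, hv, ?_⟩
    rwa [ht, ← List.take_left (l₁ := p.map (Prod.map c id)), ← hs']
  | cup i d =>
    obtain ⟨hi, v, m', rfl, h⟩ := h
    rw [top, List.length_map] at hi
    have hs := D.strands.take_append_drop i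
    have ht := List.map_congr_left (hD.map_update_strands c v)
    refine ⟨{ D with
      strands := D.strands.take i ++ (D.arcs, d) :: (D.arcs, !d) :: D.strands.drop i
      arcs := D.arcs + 1 }, Function.update c D.arcs v, m', ?_, hn v, hD.isColoring_update hc v, ?_⟩
    · have := IsStep.cup d hs.symm
      rwa [List.length_take_of_le hi] at this
    · simpa [top, List.map_take, List.map_drop, ht] using h
  | cap i =>
    obtain ⟨_, _, _, hs, hxy, h⟩ := h
    obtain ⟨_, rfl, hs'⟩ := eq_append_of_drop_eq hs
    obtain ⟨p, ⟨a, d⟩, ⟨b, e⟩, r, hD', rfl, rfl, rfl, rfl⟩ :=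
      exists_of_map_eq_append_cons_cons hs'
    obtain ⟨hab, rfl⟩ : c b = c a ∧ e = !d := by simpa using hxy
    refine ⟨{ D with strands := p ++ r, joins := D.joins ++ [(a, b)] }, c, m,
      by rw [List.length_map]; exact .cap hD', fun _ _ => rfl, ⟨hc.1, ?_⟩, ?_⟩
    · simpa [or_imp, forall_and, hab] using hc.2
    · rw [hs', List.take_left] at h
      simpa [top] using h

theorem WellFormed.exists_isColoring (hD : D.WellFormed) (hc : D.IsColoring Q c)
    (h : IsTrace Q w (D.top c) m t) :
    ∃ D' c', D.run w = some D' ∧ (∀ a < D.arcs, c' a = c a) ∧ D'.IsColoring Q c' := by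
  induction w generalizing D c m with
  | nil => exact ⟨D, c, rfl, fun _ _ => rfl, hc⟩
  | cons l w ih =>
    obtain ⟨D₁, c₁, m₁, h₁, hc₁, hcol, h⟩ := hD.exists_isStep hc h
    obtain ⟨D', c', h', hc', hcol'⟩ := ih (h₁.wellFormed hD) hcol h
    exact ⟨D', c', run_cons_eq_some_iff.2 ⟨D₁, h₁, h'⟩,
      fun a ha => (hc' a (ha.trans_le h₁.arcs_le)).trans (hc₁ a ha), hcol'⟩

end

end Diagram

theorem IsTrace.exists_isStep {Q : LinearRack V} {l : Letter} {w : List Letter}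
    {s m t : List (V × Bool)} (h : IsTrace Q (l :: w) s m t) :
    ∃ (s' m' : List (V × Bool)) (k : ℤ), IsTrace Q w s' m' t ∧
      ∀ D : Diagram, D.strands.map Prod.snd = s.map Prod.snd → ∃ D₁, D.IsStep l D₁ ∧
        D₁.strands.map Prod.snd = s'.map Prod.snd ∧ D₁.writhe = D.writhe + k := by
  cases l with
  | cross i o =>
    obtain ⟨x, y, r, hs, h⟩ := h
    obtain ⟨p, rfl, rfl⟩ := eq_append_of_drop_eq hs
    refine ⟨_, m, crossingSign o x.2 y.2, h, fun D hD => ?_⟩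
    obtain ⟨p', ⟨a, d⟩, ⟨b, e⟩, r', hD, hp, rfl, rfl, hr⟩ :=
      exists_of_map_eq_append_cons_cons (by simpa using hD)
    refine ⟨D.cross o p' (a, x.2) (b, y.2) r', ?_,
      by cases o <;> simp [Diagram.cross, hp, hr, LinearRack.crossing], rfl⟩
    rw [show p.length = p'.length by simpa using (congrArg List.length hp).symm]
    exact .cross o hD
  | cup i d =>
    obtain ⟨hi, a, m', rfl, h⟩ := h
    refine ⟨_, m', 0, h, fun D hD => ?_⟩
    have hl : D.strands.length = s.length := by simpa using congrArg List.length hD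
    refine ⟨{ D with
      strands := D.strands.take i ++ (D.arcs, d) :: (D.arcs, !d) :: D.strands.drop i
      arcs := D.arcs + 1 }, ?_, by simp [List.map_take, List.map_drop, hD], (add_zero _).symm⟩
    have := Diagram.IsStep.cup d (List.take_append_drop i D.strands).symm
    rwa [List.length_take_of_le (hi.trans_eq hl.symm)] at this
  | cap i =>
    obtain ⟨x, _, r, hs, rfl, h⟩ := h
    obtain ⟨p, rfl, rfl⟩ := eq_append_of_drop_eq hs
    refine ⟨_, m, 0, h, fun D hD => ?_⟩
    obtain ⟨p', ⟨a, d⟩, ⟨b, e⟩, r', hD, hp, rfl, rfl, hr⟩ :=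
      exists_of_map_eq_append_cons_cons (by simpa using hD)
    refine ⟨{ D with strands := p' ++ r', joins := D.joins ++ [(a, b)] }, ?_, by simp [hp, hr],
      (add_zero _).symm⟩
    rw [show p.length = p'.length by simpa using (congrArg List.length hp).symm]
    exact .cap hD

theorem IsTrace.exists_run_eq {Q : LinearRack V} {w : List Letter} {s m t : List (V × Bool)}
    (h : IsTrace Q w s m t) :
    ∃ k : ℤ, ∀ D : Diagram, D.strands.map Prod.snd = s.map Prod.snd → ∃ D', D.run w = some D' ∧
      D'.strands.map Prod.snd = t.map Prod.snd ∧ D'.writhe = D.writhe + k := by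
  induction w generalizing s m with
  | nil => exact ⟨0, fun D hD => ⟨D, rfl, by rw [hD, h.2], (add_zero _).symm⟩⟩
  | cons l w ih =>
    obtain ⟨s', m', k, h, hstep⟩ := h.exists_isStep
    obtain ⟨k', hk'⟩ := ih h
    refine ⟨k + k', fun D hD => ?_⟩
    obtain ⟨D₁, h₁, hs₁, hw₁⟩ := hstep D hD
    obtain ⟨D', h', hs', hw'⟩ := hk' D₁ hs₁
    exact ⟨D', Diagram.run_cons_eq_some_iff.2 ⟨D₁, h₁, h'⟩, hs', by rw [hw', hw₁, add_assoc]⟩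

/-! ### Zero-framed bands and Whitehead doubles -/

/-- The long knot `J` does not change the colours of a strand, except for the kinks that make up
its blackboard framing; this is the only way to colour `J`. -/
def TriviallyColored (Q : LinearRack V) (J : List Letter) : Prop :=
  ∀ a, UniqueTrace Q J [(a, true)] [((Q.kink ^ (-writhe J)) a, true)]

namespace LinearRack

/-- The action of a positive kink in each of two parallel strands on their colours, where the
orientation of the strands is as in `doubleLetter`. -/
def kinks (Q : LinearRack V) (par : Bool) : Equiv.Perm (V × V) :=
  Q.kink.prodCongr (if par then Q.kink else Q.kink⁻¹)

/-- The action of a full left-handed twist of two parallel strands on their colours: a kink in the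
band, with the kinks in each strand undone. -/
def fullTwist (Q : LinearRack V) (par : Bool) : Equiv.Perm (V × V) :=
  (Q.kinks par)⁻¹ * (Q.double par).kink

variable {Q : LinearRack V} {par : Bool}

theorem commute_kinks_kink_double : Commute (Q.kinks par) (Q.double par).kink := by
  ext ⟨a, b⟩ <;> cases par
  · change Q.kink (a + Q.T.symm (Q.L (a - b))) =
      Q.kink a + Q.T.symm (Q.L (Q.kink a - Q.kink⁻¹ b))
    simp only [kink_apply, kink_inv_apply, map_add, map_sub, Q.L_T, Q.L_L, Q.L_T_symm,
      AddEquiv.apply_symm_apply, AddEquiv.symm_apply_apply]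
    abel
  · change Q.kink (Q.T (Q.T a) + (Q.T (Q.L a) + Q.L b)) =
      Q.T (Q.T (Q.kink a)) + (Q.T (Q.L (Q.kink a)) + Q.L (Q.kink b))
    simp only [kink_apply, map_add, map_sub, Q.L_T, Q.L_L]
    abel
  · change Q.kink⁻¹ (b + Q.T.symm (Q.L (a - b))) =
      Q.kink⁻¹ b + Q.T.symm (Q.L (Q.kink a - Q.kink⁻¹ b))
    simp only [kink_apply, kink_inv_apply, map_add, map_sub, Q.L_T, Q.L_L, Q.L_T_symm,
      AddEquiv.symm_apply_apply]
    abel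
  · change Q.kink (Q.T (Q.T b) + (Q.T (Q.L a) + Q.L b)) =
      Q.T (Q.T (Q.kink b)) + (Q.T (Q.L (Q.kink a)) + Q.L (Q.kink b))
    simp only [kink_apply, map_add, map_sub, Q.L_T, Q.L_L]
    abel

theorem fullTwist_true_apply (a b : V) : Q.fullTwist true (a, b) =
    (Q.T a + Q.L b, Q.L (Q.T a + Q.L b) + Q.T b) := by
  rw [fullTwist, Equiv.Perm.mul_apply, Equiv.Perm.inv_eq_iff_eq]
  change (Q.T (Q.T a) + (Q.T (Q.L a) + Q.L b), Q.T (Q.T b) + (Q.T (Q.L a) + Q.L b)) =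
    (Q.kink (Q.T a + Q.L b), Q.kink (Q.L (Q.T a + Q.L b) + Q.T b))
  ext <;> simp only [kink_apply, map_add, map_sub, Q.L_T, Q.L_L] <;> abel

theorem fullTwist_false_apply (a b : V) : Q.fullTwist false (a, b) =
    (Q.T.symm (a - Q.L b), Q.L (Q.T.symm (a - Q.L b)) + Q.T b) := by
  rw [fullTwist, Equiv.Perm.mul_apply, Equiv.Perm.inv_eq_iff_eq]
  change (a + Q.T.symm (Q.L (a - b)), b + Q.T.symm (Q.L (a - b))) =
    (Q.kink (Q.T.symm (a - Q.L b)), Q.kink⁻¹ (Q.L (Q.T.symm (a - Q.L b)) + Q.T b))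
  ext <;>
    simp only [kink_apply, kink_inv_apply, map_add, map_sub, Q.L_T, Q.L_L, Q.L_T_symm,
      AddEquiv.apply_symm_apply, AddEquiv.symm_apply_apply] <;>
    abel

theorem kinks_zpow_apply (k : ℤ) (a b : V) :
    (Q.kinks par ^ k) (a, b) = ((Q.kink ^ k) a, (Q.kink ^ (if par then k else -k)) b) := by
  let φ : Equiv.Perm V × Equiv.Perm V →* Equiv.Perm (V × V) :=
    { toFun e := e.1.prodCongr e.2, map_one' := rfl, map_mul' _ _ := rfl }
  have h := map_zpow φ (Q.kink, if par then Q.kink else Q.kink⁻¹) k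
  rw [show Q.kinks par = φ (Q.kink, if par then Q.kink else Q.kink⁻¹) from rfl, ← h]
  cases par
  · exact congrArg (Prod.mk _) (by simp)
  · rfl

end LinearRack

section

variable {Q : LinearRack V} {par : Bool} {J : List Letter}

theorem replicate_two_mul_cross (n i : ℕ) (o : Bool) :
    List.replicate (2 * n) (Letter.cross i o) = connectedSum n [.cross i o, .cross i o] := by
  rw [mul_comm]
  exact List.flatten_replicate_replicate.symm

theorem uniqueTrace_fullTwist (a : V × V) :
    UniqueTrace Q [.cross 0 false, .cross 0 false] (flat par [(a, true)])
      (flat par [(Q.fullTwist par a, true)]) := by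
  obtain ⟨a, b⟩ := a
  refine ⟨[], fun m t => ?_⟩
  cases par <;>
    simp only [IsTrace, LinearRack.crossing, flat, LinearRack.fullTwist_false_apply,
      LinearRack.fullTwist_true_apply, exists_cons_cons_eq_and, List.drop_zero, List.take_zero,
      List.cons_append, List.nil_append, List.flatMap_cons, List.flatMap_nil, if_true,
      List.append_nil] <;>
    simp [LinearRack.under, add_comm]

theorem uniqueTrace_fullTwist_inv (a : V × V) :
    UniqueTrace Q [.cross 0 true, .cross 0 true] (flat par [(a, true)])
      (flat par [((Q.fullTwist par)⁻¹ a, true)]) := by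
  obtain ⟨⟨a, b⟩, rfl⟩ := (Q.fullTwist par).surjective a
  rw [Equiv.Perm.inv_def, Equiv.symm_apply_apply]
  refine ⟨[], fun m t => ?_⟩
  cases par <;>
    simp only [IsTrace, LinearRack.crossing, flat, LinearRack.fullTwist_false_apply,
      LinearRack.fullTwist_true_apply, exists_cons_cons_eq_and, List.drop_zero, List.take_zero,
      List.cons_append, List.nil_append, List.flatMap_cons, List.flatMap_nil, if_true,
      List.append_nil] <;>
    simp [LinearRack.under, add_comm]

theorem uniqueTrace_halfTwists_neg_two_mul (k : ℤ) (a : V × V) :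
    UniqueTrace Q (halfTwists 0 (-2 * k)) (flat par [(a, true)])
      (flat par [((Q.fullTwist par ^ k) a, true)]) := by
  obtain ⟨n, rfl | rfl⟩ := k.eq_nat_or_neg
  · have h : halfTwists 0 (-2 * n) = connectedSum n [.cross 0 false, .cross 0 false] := by
      rw [← replicate_two_mul_cross, halfTwists, decide_eq_false (by lia)]
      congr 1
      lia
    rw [h, zpow_natCast, ← Equiv.Perm.iterate_eq_pow]
    exact .connectedSum uniqueTrace_fullTwist n a
  · have h : halfTwists 0 (-2 * -n) = connectedSum n [.cross 0 true, .cross 0 true] := by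
      obtain rfl | hn := n.eq_zero_or_pos
      · rfl
      rw [← replicate_two_mul_cross, halfTwists, decide_eq_true (by lia)]
      congr 1
      lia
    rw [h, zpow_neg, ← inv_zpow, zpow_natCast, ← Equiv.Perm.iterate_eq_pow]
    exact .connectedSum uniqueTrace_fullTwist_inv n a

theorem TriviallyColored.zeroFramedBand (h : TriviallyColored (Q.double par) J) (a : V × V) :
    UniqueTrace Q (zeroFramedBand par J) (flat par [(a, true)])
      (flat par [((Q.kinks par ^ (-writhe J)) a, true)]) := by
  have := (h a).double.append (uniqueTrace_halfTwists_neg_two_mul (writhe J) _)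
  rwa [← Equiv.Perm.mul_apply, LinearRack.fullTwist,
    LinearRack.commute_kinks_kink_double.inv_left.mul_zpow, mul_assoc, ← zpow_add, add_neg_cancel,
    zpow_zero, mul_one, inv_zpow, ← zpow_neg] at this

end

section

variable {Q : LinearRack V} {w w' J J' : List Letter} {s t m : List (V × Bool)} {a a' b : V}

theorem UniqueTrace.append_right (h : UniqueTrace Q w s t) (r : List (V × Bool)) :
    UniqueTrace Q w (s ++ r) (t ++ r) := by
  have hw : w.map (.shift 0) = w := by
    conv_rhs => rw [← List.map_id w]
    refine List.map_congr_left fun l _ => ?_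
    cases l <;> simp [Letter.shift]
  simpa [hw] using h.shift [] r

theorem UniqueTrace.writhe_append (h : UniqueTrace Q w [(a, true)] [(b, true)])
    (h' : UniqueTrace Q w' [(a', true)] t) : writhe (w ++ w') = writhe w + writhe w' := by
  obtain ⟨m, h⟩ := h
  obtain ⟨m', h'⟩ := h'
  obtain ⟨k, hk⟩ := ((h m _).2 ⟨rfl, rfl⟩).exists_run_eq
  obtain ⟨k', hk'⟩ := ((h' m' _).2 ⟨rfl, rfl⟩).exists_run_eq
  obtain ⟨D, hD, hs, hw⟩ := hk .strand rfl
  obtain ⟨D', hD', -, hw'⟩ := hk' .strand rfl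
  obtain ⟨D'', hD'', -, hw''⟩ := hk' D hs
  simp [writhe, Diagram.run_append, hD, hD', hD'', hw, hw', hw'',
    show Diagram.strand.writhe = 0 from rfl]

theorem TriviallyColored.append (h : TriviallyColored Q J) (h' : TriviallyColored Q J') :
    TriviallyColored Q (J ++ J') := fun a => by
  rw [(h a).writhe_append (h' a), neg_add_rev, zpow_add, Equiv.Perm.mul_apply]
  exact (h a).append (h' _)

theorem TriviallyColored.connectedSum (h : TriviallyColored Q J) (m : ℕ) :
    TriviallyColored Q (connectedSum m J) := by
  induction m with
  | zero => exact fun a => uniqueTrace_nil Q _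
  | succ m ih => rw [connectedSum_succ]; exact h.append ih

theorem triviallyColored_trefoil (hQ : ∀ x, Q.T x = x) : TriviallyColored Q trefoil := by
  have hQ' (x : V) : Q.T.symm x = x := by rw [Q.T.symm_apply_eq, hQ]
  have hL (x : V) : Q.L (Q.L x) = 0 := by rw [Q.L_L, hQ, sub_self]
  intro a
  have ha : (Q.kink ^ (-writhe trefoil)) a = a - Q.L a - Q.L a - Q.L a := by
    change Q.kink⁻¹ (Q.kink⁻¹ (Q.kink⁻¹ a)) = _
    simp [LinearRack.kink_inv_apply, hQ', hL]
  rw [ha]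
  refine ⟨[(a - Q.L a, true)], fun m t => ?_⟩
  have hc (c : V) : c = a - Q.L c ↔ c = a - Q.L a := by
    constructor <;> intro h
    · have hLc := congrArg Q.L h
      rw [map_sub, hL, sub_zero] at hLc
      rwa [hLc] at h
    · rw [h, map_sub, hL, sub_zero]
  simp [trefoil, halfTwists, List.replicate, IsTrace, LinearRack.crossing, LinearRack.under, hL,
    hQ', hc]

theorem isTrace_clasp_iff {A B C : V} :
    IsTrace Q [.cross 1 false, .cross 1 false, .cap 0] [(A, true), (B, false), (C, true)] m t ↔
      A = Q.L C + Q.T B ∧ m = [] ∧ t = [(Q.T.symm (C - Q.L A), true)] := by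
  simp only [IsTrace, LinearRack.crossing, LinearRack.under, exists_cons_cons_eq_and,
    List.take_succ_cons, List.take_zero, List.drop_succ_cons, List.drop_zero, List.cons_append,
    List.nil_append]
  grind

theorem uniqueTrace_whiteheadDouble (h : TriviallyColored (Q.double false) w) (a : V) :
    UniqueTrace Q (whiteheadDouble w) [(a, true)]
      [((Q.kink ^ (-(2 * writhe w + 2))) a, true)] := by
  set k := writhe w with hk
  set c₀ := (Q.kink ^ (-(2 * k + 1))) a
  choose m₁ h₁ using fun c : V => ((h.zeroFramedBand (a, c)).append_right
    [(c, true)]).isTrace_append_iff (w₂ := [.cross 1 false, .cross 1 false, .cap 0])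
  have hcap (c : V) : (Q.kink ^ (-k)) a = Q.L c + Q.T ((Q.kink ^ k) c) ↔ c = c₀ := by
    rw [add_comm, ← Q.L_kink_zpow k c, ← Q.kink_apply, ← Equiv.Perm.mul_apply, ← zpow_one_add,
      ← Equiv.Perm.inv_eq_iff_eq, ← zpow_neg, ← Equiv.Perm.mul_apply, ← zpow_add, eq_comm,
      show -(1 + k) + -k = -(2 * k + 1) by ring]
  have hend : Q.T.symm (c₀ - Q.L ((Q.kink ^ (-k)) a)) = (Q.kink ^ (-(2 * k + 2))) a := by
    rw [Q.L_kink_zpow, ← Q.L_kink_zpow (-(2 * k + 1)), ← Q.kink_inv_apply, ← Equiv.Perm.mul_apply,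
      ← zpow_neg_one, ← zpow_add]
    ring_nf
  have hband (c : V) (m t : List (V × Bool)) :
      IsTrace Q (zeroFramedBand false w ++ [.cross 1 false, .cross 1 false, .cap 0])
        [(a, true), (c, false), (c, true)] m t ↔
      c = c₀ ∧ m = m₁ c ∧ t = [(Q.T.symm (c - Q.L ((Q.kink ^ (-k)) a)), true)] := by
    refine (h₁ c m t).trans ?_
    simp only [LinearRack.kinks_zpow_apply, ← hk, neg_neg, Bool.false_eq_true, if_false, flat,
      if_true, List.flatMap_cons, List.flatMap_nil, List.cons_append, List.nil_append,
      isTrace_clasp_iff, hcap]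
    grind
  refine ⟨(c₀, false) :: m₁ c₀, fun m t => ?_⟩
  simp only [whiteheadDouble, IsTrace, List.cons_append, List.drop_succ_cons, List.drop_zero,
    List.take_succ_cons, List.take_zero, List.nil_append, Bool.not_false, hband]
  constructor
  · rintro ⟨-, _, _, rfl, rfl, rfl, rfl⟩
    exact ⟨rfl, by rw [hend]⟩
  · rintro ⟨rfl, rfl⟩
    exact ⟨by simp, c₀, _, rfl, rfl, rfl, by rw [hend]⟩

-- In `Q.double false` the actions of the two strands cancel, so that its `T` is the identity.
theorem triviallyColored_whiteheadDouble_trefoil (Q : LinearRack V) :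
    TriviallyColored Q (whiteheadDouble trefoil) :=
  uniqueTrace_whiteheadDouble (triviallyColored_trefoil fun _ => rfl)

end

/-! ### Alexander quandles and the pretzel relations -/

section

variable {R M : Type*} [CommRing R] [AddCommGroup M] [Module R M]

/-- The Alexander quandle of a module with respect to a unit `t`. -/
def alexanderQuandle (M : Type*) [AddCommGroup M] [Module R M] (t : Rˣ) : LinearRack M where
  T := DistribMulAction.toAddEquiv M t
  L := AddMonoidHom.id M - DistribSMul.toAddMonoidHom M t
  L_T x := by simp [smul_sub]
  L_L x := by simp [smul_sub]

variable {t : Rˣ} {k : ℕ} {a b u v w : M}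

theorem alexanderQuandle_T_apply : (alexanderQuandle M t).T a = (t : R) • a := rfl

theorem alexanderQuandle_L_apply : (alexanderQuandle M t).L a = (1 - (t : R)) • a := by
  rw [sub_smul, one_smul]
  rfl

theorem alexanderQuandle_T_symm_apply :
    (alexanderQuandle M t).T.symm a = ((t⁻¹ : Rˣ) : R) • a := rfl

theorem kink_alexanderQuandle : (alexanderQuandle M t).kink = 1 := by
  ext x
  rw [LinearRack.kink_apply, alexanderQuandle_T_apply, alexanderQuandle_L_apply, ← add_smul,
    add_sub_cancel, one_smul]
  rfl

theorem kinks_alexanderQuandle (par : Bool) : (alexanderQuandle M t).kinks par = 1 := by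
  rw [LinearRack.kinks, kink_alexanderQuandle]
  cases par <;> rfl

theorem under_true_alexanderQuandle :
    (alexanderQuandle M t).under a true b = a - ((t⁻¹ : Rˣ) : R) • (a - b) := by
  rw [LinearRack.under, if_pos rfl, alexanderQuandle_T_symm_apply, alexanderQuandle_L_apply]
  linear_combination (norm := module) t.inv_mul • a

theorem halfTwists_natCast (i n : ℕ) : halfTwists i n = List.replicate n (.cross i true) := by
  obtain rfl | hn := n.eq_zero_or_pos
  · rfl
  · simp [halfTwists, hn]

theorem halfTwists_neg_natCast (i n : ℕ) :
    halfTwists i (-n) = List.replicate n (.cross i false) := by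
  simp [halfTwists]

theorem map_shift_halfTwists (i : ℕ) (k : ℤ) :
    (halfTwists 0 k).map (.shift i) = halfTwists i k := by
  simp [halfTwists, Letter.shift]

theorem UniqueTrace.halfTwists {Q : LinearRack V} {k : ℤ} {s s' : List (V × Bool)}
    (h : UniqueTrace Q (halfTwists 0 k) s s') (p r : List (V × Bool)) :
    UniqueTrace Q (halfTwists p.length k) (p ++ (s ++ r)) (p ++ (s' ++ r)) := by
  rw [← map_shift_halfTwists]
  exact h.shift p r

theorem uniqueTrace_halfTwists_natCast (n : ℕ) (a b : M) :
    UniqueTrace (alexanderQuandle M t) (halfTwists 0 n) [(a, true), (b, true)]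
      [(b + altGeomSum ((t⁻¹ : Rˣ) : R) (n + 1) • (a - b), true),
        (b + altGeomSum ((t⁻¹ : Rˣ) : R) n • (a - b), true)] := by
  rw [halfTwists_natCast]
  induction n generalizing a b with
  | zero => simpa [altGeomSum] using uniqueTrace_nil _ _
  | succ n ih =>
    have h (j : ℕ) :
        a + altGeomSum ((t⁻¹ : Rˣ) : R) j • ((alexanderQuandle M t).under a true b - a) =
          b + altGeomSum ((t⁻¹ : Rˣ) : R) (j + 1) • (a - b) := by
      rw [under_true_alexanderQuandle, altGeomSum_succ]
      module
    rw [← h, ← h]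
    exact (uniqueTrace_cross _ true [] (a, true) (b, true) []).append (ih _ _)

theorem uniqueTrace_halfTwists_neg_natCast (n : ℕ) (a b : M) :
    UniqueTrace (alexanderQuandle M t) (halfTwists 0 (-n)) [(a, false), (b, false)]
      [(a - altGeomSum ((t⁻¹ : Rˣ) : R) n • (a - b), false),
        (a - altGeomSum ((t⁻¹ : Rˣ) : R) (n + 1) • (a - b), false)] := by
  rw [halfTwists_neg_natCast]
  induction n generalizing a b with
  | zero => simpa [altGeomSum] using uniqueTrace_nil _ _
  | succ n ih =>
    have h (j : ℕ) :
        b - altGeomSum ((t⁻¹ : Rˣ) : R) j • (b - (alexanderQuandle M t).under b true a) =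
          a - altGeomSum ((t⁻¹ : Rˣ) : R) (j + 1) • (a - b) := by
      rw [under_true_alexanderQuandle, altGeomSum_succ]
      module
    rw [← h, ← h]
    exact (uniqueTrace_cross _ false [] (a, false) (b, false) []).append (ih _ _)

theorem fullTwist_false_zpow_alexanderQuandle (k : ℤ) (a b : M) :
    ((alexanderQuandle M t).fullTwist false ^ k) (a, b) =
      (a + (k * (((t⁻¹ : Rˣ) : R) - 1)) • (a - b), b + (k * (((t⁻¹ : Rˣ) : R) - 1)) • (a - b)) := by
  let f (x : M × M) : M × M :=
    ((((t⁻¹ : Rˣ) : R) - 1) • (x.1 - x.2), (((t⁻¹ : Rˣ) : R) - 1) • (x.1 - x.2))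
  have he (x : M × M) : (alexanderQuandle M t).fullTwist false x = x + f x := by
    rw [LinearRack.fullTwist_false_apply, alexanderQuandle_T_symm_apply]
    simp only [alexanderQuandle_T_apply, alexanderQuandle_L_apply]
    ext
    · simp only [f, Prod.fst_add]
      linear_combination (norm := module) t.inv_mul • x.2
    · simp only [f, Prod.snd_add]
      linear_combination (norm := module) t.inv_mul • ((2 - (t : R)) • x.2 - x.1)
  rw [perm_zpow_apply_eq_add_zsmul he]
  · ext <;> simp [f, mul_smul, Int.cast_smul_eq_zsmul]
  · intro x
    simp [he, f]

theorem uniqueTrace_halfTwists_two_mul (k : ℤ) (a b : M) :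
    UniqueTrace (alexanderQuandle M t) (halfTwists 0 (2 * k)) [(a, true), (b, false)]
      [(a + (k * (1 - ((t⁻¹ : Rˣ) : R))) • (a - b), true),
        (b + (k * (1 - ((t⁻¹ : Rˣ) : R))) • (a - b), false)] := by
  rw [show (k * (1 - ((t⁻¹ : Rˣ) : R))) = (-k : ℤ) * (((t⁻¹ : Rˣ) : R) - 1) by push_cast; ring,
    show 2 * k = -2 * -k by ring]
  have := uniqueTrace_halfTwists_neg_two_mul (Q := alexanderQuandle M t) (par := false) (-k) (a, b)
  rwa [fullTwist_false_zpow_alexanderQuandle] at this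

/-- The relations between the colours of the three lowest local minima of `K (2 * k + 1) J`, from
left to right, that the pretzel part of the diagram enforces. -/
structure PretzelRelations (t : Rˣ) (k : ℕ) (u v w : M) : Prop where
  left : altGeomSum ((t⁻¹ : Rˣ) : R) (2 * k + 1) • (u - w) = 0
  right : (k * (1 - ((t⁻¹ : Rˣ) : R))) • (u - w) +
    (((t⁻¹ : Rˣ) : R) * altGeomSum ((t⁻¹ : Rˣ) : R) (2 * k + 1)) • (v - w) = 0

/-- The part of `K n J` above the three lowest local minima. -/
def upperPart (n : ℕ) (J : List Letter) : List Letter :=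
  zeroFramedBand true J ++ (halfTwists 0 n ++ (halfTwists 2 (-n) ++ halfTwists 4 (n - 1))) ++
    [.cap 1, .cap 1, .cap 0]

theorem K_eq (n : ℕ) (J : List Letter) :
    K n J = [.cup 0 true, .cup 1 true, .cup 3 false] ++ upperPart n J := by
  simp [K, upperPart]

theorem uniqueTrace_pretzel (k : ℕ) (u v w : M) :
    UniqueTrace (alexanderQuandle M t)
      (halfTwists 0 (2 * k + 1 : ℕ) ++ (halfTwists 2 (-(2 * k + 1 : ℕ)) ++ halfTwists 4 (2 * k)))
      [(u, true), (v, true), (v, false), (w, false), (w, true), (u, false)]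
      [(v + altGeomSum ((t⁻¹ : Rˣ) : R) (2 * k + 2) • (u - v), true),
        (v + altGeomSum ((t⁻¹ : Rˣ) : R) (2 * k + 1) • (u - v), true),
        (v - altGeomSum ((t⁻¹ : Rˣ) : R) (2 * k + 1) • (v - w), false),
        (v - altGeomSum ((t⁻¹ : Rˣ) : R) (2 * k + 2) • (v - w), false),
        (w + (k * (1 - ((t⁻¹ : Rˣ) : R))) • (w - u), true),
        (u + (k * (1 - ((t⁻¹ : Rˣ) : R))) • (w - u), false)] := by
  have h := uniqueTrace_halfTwists_two_mul (t := t) k w u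
  rw [Int.cast_natCast] at h
  exact ((uniqueTrace_halfTwists_natCast _ _ _).halfTwists [] _).append
    (((uniqueTrace_halfTwists_neg_natCast _ _ _).halfTwists [(_, true), (_, true)] _).append
      (h.halfTwists [(_, true), (_, true), (_, false), (_, false)] []))

theorem isTrace_caps_iff {Q : LinearRack V} {a b c d e f : V} {m s : List (V × Bool)} :
    IsTrace Q [.cap 1, .cap 1, .cap 0]
        [(a, true), (b, true), (c, false), (d, false), (e, true), (f, false)] m s ↔
      (c = b ∧ e = d ∧ f = a) ∧ m = [] ∧ s = [] := by
  simp only [IsTrace, exists_cons_cons_eq_and, List.take_succ_cons, List.take_zero,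
    List.drop_succ_cons, List.drop_zero, List.cons_append, List.nil_append]
  grind

theorem pretzelRelations_iff :
    PretzelRelations t k u v w ↔
      v - altGeomSum ((t⁻¹ : Rˣ) : R) (2 * k + 1) • (v - w) =
          v + altGeomSum ((t⁻¹ : Rˣ) : R) (2 * k + 1) • (u - v) ∧
        w + (k * (1 - ((t⁻¹ : Rˣ) : R))) • (w - u) =
          v - altGeomSum ((t⁻¹ : Rˣ) : R) (2 * k + 2) • (v - w) ∧
        u + (k * (1 - ((t⁻¹ : Rˣ) : R))) • (w - u) =
          v + altGeomSum ((t⁻¹ : Rˣ) : R) (2 * k + 2) • (u - v) := by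
  rw [altGeomSum_succ _ (2 * k + 1)]
  constructor
  · rintro ⟨h₁, h₂⟩
    refine ⟨?_, ?_, ?_⟩
    · linear_combination (norm := module) -h₁
    · linear_combination (norm := module) -h₂
    · linear_combination (norm := module) ((t⁻¹ : Rˣ) : R) • h₁ - h₂
  · rintro ⟨h₁, h₂, -⟩
    refine ⟨?_, ?_⟩
    · linear_combination (norm := module) -h₁
    · linear_combination (norm := module) -h₂

theorem exists_isTrace_upperPart_iff {J : List Letter}
    (hJ : TriviallyColored ((alexanderQuandle M t).double true) J) (u v w : M) :
    ∃ m₀, ∀ m s, IsTrace (alexanderQuandle M t) (upperPart (2 * k + 1) J)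
        [(u, true), (v, true), (v, false), (w, false), (w, true), (u, false)] m s ↔
      PretzelRelations t k u v w ∧ m = m₀ ∧ s = [] := by
  have hband := (hJ.zeroFramedBand (u, v)).append_right
    [(v, false), (w, false), (w, true), (u, false)]
  rw [kinks_alexanderQuandle, one_zpow] at hband
  obtain ⟨m₀, h⟩ := (hband.append (uniqueTrace_pretzel k u v w)).isTrace_append_iff
    (w₂ := [.cap 1, .cap 1, .cap 0])
  refine ⟨m₀, fun m s => ?_⟩
  rw [upperPart, show ((2 * k + 1 : ℕ) : ℤ) - 1 = 2 * k by push_cast; ring]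
  refine (h m s).trans ?_
  simp only [isTrace_caps_iff, ← pretzelRelations_iff]
  constructor
  · rintro ⟨_, rfl, h, rfl, rfl⟩
    exact ⟨h, List.append_nil _, rfl⟩
  · rintro ⟨hr, rfl, rfl⟩
    exact ⟨[], (List.append_nil _).symm, hr, rfl, rfl⟩

/-- The diagram that consists of the three lowest local minima of `K n J`. -/
def lowerPart : Diagram :=
  ⟨[(0, true), (1, true), (1, false), (2, false), (2, true), (0, false)], 3, [], [], 0⟩

theorem wellFormed_lowerPart : lowerPart.WellFormed := by
  constructor <;> simp [lowerPart]

theorem run_K (n : ℕ) (J : List Letter) :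
    Diagram.empty.run (K n J) = lowerPart.run (upperPart n J) := by
  rw [K_eq, Diagram.run_append]
  rfl

variable {D : Diagram} {J : List Letter} {c : ℕ → M}

theorem Diagram.IsColoring.pretzelRelations
    (hJ : TriviallyColored ((alexanderQuandle M t).double true) J)
    (hD : empty.run (K (2 * k + 1) J) = some D) (hc : D.IsColoring (alexanderQuandle M t) c) :
    PretzelRelations t k (c 0) (c 1) (c 2) := by
  rw [run_K] at hD
  obtain ⟨m, h, -⟩ := exists_isTrace_of_run hD wellFormed_lowerPart hc
  obtain ⟨m₀, hm₀⟩ := exists_isTrace_upperPart_iff (k := k) hJ (c 0) (c 1) (c 2)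
  exact ((hm₀ _ _).1 h).1

theorem Diagram.IsColoring.strands_eq_nil
    (hJ : TriviallyColored ((alexanderQuandle M t).double true) J)
    (hD : empty.run (K (2 * k + 1) J) = some D) (hc : D.IsColoring (alexanderQuandle M t) c) :
    D.strands = [] := by
  rw [run_K] at hD
  obtain ⟨m, h, -⟩ := exists_isTrace_of_run hD wellFormed_lowerPart hc
  obtain ⟨m₀, hm₀⟩ := exists_isTrace_upperPart_iff (k := k) hJ (c 0) (c 1) (c 2)
  exact List.map_eq_nil_iff.1 ((hm₀ _ _).1 h).2.2

theorem Diagram.IsColoring.eq_zero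
    (hJ : TriviallyColored ((alexanderQuandle M t).double true) J)
    (hD : empty.run (K (2 * k + 1) J) = some D) (hc : D.IsColoring (alexanderQuandle M t) c)
    (h₀ : c 0 = 0) (h₁ : c 1 = 0) (h₂ : c 2 = 0) : ∀ a < D.arcs, c a = 0 := by
  rw [run_K] at hD
  obtain ⟨m, h, hzero⟩ := exists_isTrace_of_run hD wellFormed_lowerPart hc
  obtain ⟨m₀, hm₀⟩ := exists_isTrace_upperPart_iff (k := k) hJ (c 0) (c 1) (c 2)
  refine hzero (fun a ha => ?_) ?_
  · change a < 3 at ha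
    interval_cases a <;> assumption
  · have htop : (lowerPart.top c).map (Prod.map 0 id) = lowerPart.top c := by
      simp [top, lowerPart, h₀, h₁, h₂]
    have hm : m.map (Prod.map 0 id) = m := by
      have h' := h.map_zero
      rw [htop] at h'
      exact ((hm₀ _ _).1 h').2.1.trans ((hm₀ _ _).1 h).2.1.symm
    intro x hx
    rw [← hm] at hx
    obtain ⟨y, -, rfl⟩ := List.mem_map.1 hx
    rfl

theorem PretzelRelations.exists_isColoring
    (hJ : TriviallyColored ((alexanderQuandle M t).double true) J)
    (h : PretzelRelations t k u v w) :
    ∃ D c, Diagram.empty.run (K (2 * k + 1) J) = some D ∧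
      D.IsColoring (alexanderQuandle M t) c ∧ c 0 = u ∧ c 1 = v ∧ c 2 = w := by
  obtain ⟨m, hm⟩ := exists_isTrace_upperPart_iff (k := k) hJ u v w
  let c : ℕ → M
    | 0 => u
    | 1 => v
    | _ => w
  have hc : lowerPart.IsColoring (alexanderQuandle M t) c := by
    constructor <;> simp [lowerPart]
  obtain ⟨D, c', hD, hcc', hc'⟩ :=
    wellFormed_lowerPart.exists_isColoring hc ((hm _ _).2 ⟨h, rfl, rfl⟩)
  rw [run_K]
  exact ⟨D, c', hD, hc', hcc' 0 (by decide), hcc' 1 (by decide), hcc' 2 (by decide)⟩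

end

/-! ### The Alexander ideal -/

section

variable {R M : Type*} [CommRing R] [AddCommGroup M] [Module R M] {t : Rˣ} {k : ℕ}

/-- The matrix of the relations `PretzelRelations t k u v w` in the generators `u - w` and
`v - w`. -/
def pretzelMatrix (t : Rˣ) (k : ℕ) : Matrix (Fin 2) (Fin 2) R :=
  !![altGeomSum ((t⁻¹ : Rˣ) : R) (2 * k + 1), 0;
    k * (1 - ((t⁻¹ : Rˣ) : R)), ((t⁻¹ : Rˣ) : R) * altGeomSum ((t⁻¹ : Rˣ) : R) (2 * k + 1)]

/-- The matrix that expresses `u - w` and `v - w` in terms of `u`, `v` and `w`. -/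
def differenceMatrix (R : Type*) [CommRing R] : Matrix (Fin 2) (Fin 3) R :=
  !![1, 0, -1; 0, 1, -1]

theorem isSolution_pretzelMatrix_mul_iff {v : Fin 3 → M} :
    IsSolution (pretzelMatrix t k * differenceMatrix R) v ↔
      PretzelRelations t k (v 0) (v 1) (v 2) := by
  have h (i : Fin 2) : ∑ j, (pretzelMatrix t k * differenceMatrix R) i j • v j =
      pretzelMatrix t k i 0 • (v 0 - v 2) + pretzelMatrix t k i 1 • (v 1 - v 2) := by
    simp only [differenceMatrix, Matrix.mul_apply, Fin.sum_univ_three, Fin.sum_univ_two,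
      Matrix.of_apply, Matrix.cons_val]
    module
  rw [IsSolution, Fin.forall_fin_two, h, h]
  simp only [pretzelMatrix, Matrix.of_apply, Matrix.cons_val, zero_smul, add_zero]
  exact ⟨fun h => ⟨h.1, h.2⟩, fun h => ⟨h.left, h.right⟩⟩

theorem associated_det_pretzelMatrix :
    Associated (pretzelMatrix t k).det (altGeomSum (t : R) (2 * k + 1) ^ 2) := by
  refine ⟨t ^ (4 * k + 1), ?_⟩
  rw [pretzelMatrix, Matrix.det_fin_two_of, ← pow_mul_altGeomSum_inv t]
  push_cast
  linear_combination (t : R) ^ (4 * k) * altGeomSum ((t⁻¹ : Rˣ) : R) (2 * k + 1) ^ 2 * t.inv_mul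

end

section IsKnot

variable {k : ℕ} {D : Diagram} {J : List Letter}

theorem isKnot_of_run_K (hJ : TriviallyColored ((alexanderQuandle ℤ (1 : ℤˣ)).double true) J)
    (hD : Diagram.empty.run (K (2 * k + 1) J) = some D) : D.IsKnot := by
  classical
  let c (a : ℕ) : ℤ := if Relation.EqvGen D.Adjacent 0 a then 0 else 1
  have hadj {a b : ℕ} (h : D.Adjacent a b) : c a = c b := by
    have : Relation.EqvGen D.Adjacent 0 a ↔ Relation.EqvGen D.Adjacent 0 b :=
      ⟨fun h₀ => h₀.trans _ _ _ (.rel _ _ h), fun h₀ => h₀.trans _ _ _ (.symm _ _ (.rel _ _ h))⟩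
    simp only [c, this]
  have hc : D.IsColoring (alexanderQuandle ℤ (1 : ℤˣ)) c := by
    refine ⟨fun x hx => ?_, fun x hx => hadj (Or.inr hx)⟩
    rw [← hadj (Or.inl ⟨x.1, hx⟩), alexanderQuandle_L_apply, alexanderQuandle_T_apply]
    simp
  have h₀ : c 0 = 0 := if_pos (.refl _)
  obtain ⟨h₁, h₂⟩ := hc.pretzelRelations hJ hD
  have hsum : altGeomSum (1 : ℤ) (2 * k + 1) = 1 := by
    have := one_add_mul_altGeomSum (1 : ℤ) (2 * k + 1)
    rw [Odd.neg_one_pow ⟨k, rfl⟩] at this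
    omega
  have hzero : ∀ a < D.arcs, c a = 0 := by
    simp only [inv_one, Units.val_one, hsum, h₀, zero_sub, smul_eq_mul, one_mul, neg_eq_zero,
      sub_self, mul_zero, zero_mul, zero_add] at h₁ h₂
    exact hc.eq_zero hJ hD h₀ (by omega) (by omega)
  have hconn (a : ℕ) (ha : a < D.arcs) : Relation.EqvGen D.Adjacent 0 a := by
    by_contra h
    exact one_ne_zero ((if_neg h).symm.trans (hzero a ha))
  have harcs : lowerPart.arcs ≤ D.arcs := Diagram.arcs_le_of_run ((run_K _ _).symm.trans hD)
  exact ⟨hc.strands_eq_nil hJ hD, (Nat.succ_pos 2).trans_le harcs,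
    fun a ha b hb => ((hconn a ha).symm).trans _ _ _ (hconn b hb)⟩

end IsKnot

open LaurentPolynomial

/-- The unit `t` of the ring of Laurent polynomials. -/
noncomputable def tUnit : (ℤ[T;T⁻¹])ˣ where
  val := T 1
  inv := T (-1)
  val_inv := by rw [← T_add, add_neg_cancel, T_zero]
  inv_val := by rw [← T_add, neg_add_cancel, T_zero]

section Rows

variable {M : Type*} [AddCommGroup M] [Module ℤ[T;T⁻¹] M] {N a b : ℕ} {x : ℕ × ℕ × ℕ}

theorem sum_ite_smul (c : ℕ → M) (ha : a < N) (p : ℤ[T;T⁻¹]) :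
    ∑ j : Fin N, (if (j : ℕ) = a then p else 0) • c j = p • c a := by
  rw [Fin.sum_univ_eq_sum_range fun j => (if j = a then p else 0) • c j]
  simp [ite_smul, ha]

theorem sum_crossingRow_smul (c : ℕ → M) (h₁ : x.1 < N) (h₂ : x.2.1 < N) (h₃ : x.2.2 < N) :
    ∑ j : Fin N, crossingRow x j • c j =
      (alexanderQuandle M tUnit).L (c x.1) + (alexanderQuandle M tUnit).T (c x.2.1) - c x.2.2 := by
  simp only [crossingRow, add_smul, sub_smul _ _ (c _), Finset.sum_add_distrib,
    Finset.sum_sub_distrib, sum_ite_smul c h₁, sum_ite_smul c h₂, sum_ite_smul c h₃, one_smul,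
    alexanderQuandle_L_apply, alexanderQuandle_T_apply, tUnit]

theorem sum_joinRow_smul (c : ℕ → M) (ha : a < N) (hb : b < N) :
    ∑ j : Fin N, joinRow (a, b) j • c j = c a - c b := by
  simp only [joinRow, sub_smul, Finset.sum_sub_distrib, sum_ite_smul c ha, sum_ite_smul c hb,
    one_smul]

theorem Diagram.WellFormed.isColoring_iff_isSolution {D : Diagram} (hD : D.WellFormed) (c : ℕ → M) :
    D.IsColoring (alexanderQuandle M tUnit) c ↔ IsSolution D.alexanderMatrix fun j => c j := by
  have hrows : IsSolution D.alexanderMatrix (fun j => c j) ↔ ∀ ρ ∈ D.rows, ∑ j, ρ j • c j = 0 :=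
    (List.forall_mem_iff_get (p := fun ρ : Fin D.arcs → ℤ[T;T⁻¹] => ∑ j, ρ j • c j = 0)).symm
  rw [hrows]
  simp only [IsColoring, rows, List.forall_mem_append, List.forall_mem_map]
  refine and_congr (forall₂_congr fun x hx => ?_) (forall₂_congr fun x hx => ?_)
  · obtain ⟨h₁, h₂, h₃⟩ := hD.crossings x hx
    rw [sum_crossingRow_smul c h₁ h₂ h₃, sub_eq_zero, eq_comm]
  · obtain ⟨h₁, h₂⟩ := hD.joins x hx
    rw [sum_joinRow_smul c h₁ h₂, sub_eq_zero]

end Rows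

section AlexanderIdeal

variable {k l : ℕ} {D : Diagram} {J : List Letter}

theorem isElimination_alexanderMatrix
    (hJ : ∀ (V : Type) [AddCommGroup V] (Q : LinearRack V), TriviallyColored Q J)
    (hD : Diagram.empty.run (K (2 * k + 1) J) = some D) (hl : 3 + l = D.arcs) :
    IsElimination (D.alexanderMatrix.submatrix id (finSumFinEquiv.trans (finCongr hl)))
      (pretzelMatrix tUnit k * differenceMatrix ℤ[T;T⁻¹]) := by
  set e := finSumFinEquiv.trans (finCongr hl)
  have hwf : D.WellFormed := wellFormed_lowerPart.of_run ((run_K _ _).symm.trans hD)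
  have hiff {M : Type} [AddCommGroup M] [Module ℤ[T;T⁻¹] M] (c : ℕ → M) :
      D.IsColoring (alexanderQuandle M tUnit) c ↔
        IsSolution (D.alexanderMatrix.submatrix id e) (c ∘ fun i => (e i : ℕ)) :=
    (hwf.isColoring_iff_isSolution c).trans (isSolution_submatrix_equiv e).symm
  have hext {M : Type} [AddCommGroup M] :
      Function.Surjective fun (c : ℕ → M) => c ∘ fun i => (e i : ℕ) :=
    (Fin.val_injective.comp e.injective).surjective_comp_right
  refine ⟨fun M _ _ c hc => ?_, fun M _ _ v hv => ?_, fun M _ _ c hc h => ?_⟩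
  · obtain ⟨c, rfl⟩ := hext c
    exact isSolution_pretzelMatrix_mul_iff.2 (((hiff c).2 hc).pretzelRelations (hJ _ _) hD)
  · obtain ⟨D', c, hD', hc, h₀, h₁, h₂⟩ :=
      (isSolution_pretzelMatrix_mul_iff.1 hv).exists_isColoring (hJ _ _)
    obtain rfl : D = D' := Option.some.inj (hD.symm.trans hD')
    refine ⟨_, (hiff c).1 hc, ?_⟩
    ext i
    fin_cases i <;> assumption
  · obtain ⟨c, rfl⟩ := hext c
    have h' (i : Fin 3) : c i = 0 := congrFun h i
    have hzero := ((hiff c).2 hc).eq_zero (hJ _ _) hD (h' 0) (h' 1) (h' 2)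
    exact funext fun i => hzero _ (e i).isLt

theorem alexanderIdeal_eq_span
    (hJ : ∀ (V : Type) [AddCommGroup V] (Q : LinearRack V), TriviallyColored Q J)
    (hD : Diagram.empty.run (K (2 * k + 1) J) = some D) :
    D.alexanderIdeal = Ideal.span {altGeomSum (T 1) (2 * k + 1) ^ 2} := by
  obtain ⟨l, hl⟩ : ∃ l, 3 + l = D.arcs :=
    (Nat.exists_eq_add_of_le (Diagram.arcs_le_of_run ((run_K _ _).symm.trans hD))).imp
      fun _ => Eq.symm
  have hg : IsUnit ((differenceMatrix ℤ[T;T⁻¹]).submatrix id ![0, 1]).det := by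
    simp [differenceMatrix, Matrix.det_fin_two]
  change minorIdeal (Fin (D.arcs - 1)) D.alexanderMatrix = _
  rw [← minorIdeal_submatrix_equiv _ (finSumFinEquiv.trans (finCongr (by omega : 2 + l = _)))
      (finSumFinEquiv.trans (finCongr hl)),
    (isElimination_alexanderMatrix hJ hD hl).minorIdeal_eq hg]
  exact Ideal.span_singleton_eq_span_singleton.2 associated_det_pretzelMatrix

end AlexanderIdeal

end KnotDiag

open LaurentPolynomial KnotDiag in
theorem theorem5_general (n : ℕ) (hn : Odd n) {J : List Letter}
    (hJ : ∀ (V : Type) [AddCommGroup V] (Q : LinearRack V), TriviallyColored Q J) :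
    ∃ q : LaurentPolynomial ℤ, q * (T 1 + 1) = T n + 1 ∧ IsAlexanderPolynomial (K n J) (q ^ 2) := by
  obtain ⟨k, rfl⟩ := hn
  have hzero : PretzelRelations (1 : ℤˣ) k (0 : ℤ) 0 0 := ⟨by simp, by simp⟩
  obtain ⟨D, -, hD, -⟩ := hzero.exists_isColoring (hJ _ _)
  have hideal := alexanderIdeal_eq_span hJ hD
  refine ⟨altGeomSum (T 1) (2 * k + 1), ?_, D, hD, isKnot_of_run_K (hJ _ _) hD, fun x hx => ?_,
    fun q hq => hq _ ?_⟩
  · rw [mul_comm, add_comm, one_add_mul_altGeomSum, Odd.neg_pow ⟨k, rfl⟩, T_pow, mul_one,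
      sub_neg_eq_add, add_comm]
  · rwa [hideal, Ideal.mem_span_singleton] at hx
  · exact hideal ▸ Ideal.mem_span_singleton_self _

open LaurentPolynomial KnotDiag in
/-- For `n ≡ 3 mod 4`, the knot `J_n` is `connectedSum m (whiteheadDouble trefoil)` with
`m = (3 * n - 1) / 4`; the claim holds for every number `m` of summands. -/
theorem theorem5 (n m : ℕ) (hn : Odd n) :
    ∃ q : LaurentPolynomial ℤ, q * (T 1 + 1) = T n + 1 ∧
      IsAlexanderPolynomial (K n (connectedSum m (whiteheadDouble trefoil))) (q ^ 2) :=
  theorem5_general n hn fun _ _ Q =>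
    (triviallyColored_whiteheadDouble_trefoil Q).connectedSum m
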